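/- Let $e,h,f$ be the standard basis of $\mathfrak{sl}_2=\mathfrak{sl}_2(\mathbb{C})$, identify weights $\mu\in\mathfrak h^*$ with complex numbers $\mu(h)$ (so the simple root is $\alpha=2$, the root lattice is $\mathsf Q=2\mathbb Z$, and $(\mu,\mu+2\rho)=\mu(\mu+2)/2$), and let $\widehat{\mathfrak{sl}}_2=\mathfrak{sl}_2\otimes\mathbb C[t,t^{-1}]\oplus\mathbb CK\oplus\mathbb CL_0$ be the affine Kac--Moody algebra with $x_n=x\otimes t^n$, $[x_m,y_n]=[x,y]_{m+n}+m\,\delta_{m+n,0}\,\mathrm{tr}(xy)\,K$, $[L_0,x_n]=-n\,x_n$ and $K$ central. Fix a level $\mathsf k$, a conformal weight $\Delta$ and $q$ in $\mathbb C$. For a coset $\lambda\in\mathfrak h^*/\mathsf Q$ let $\mathcal D_{\lambda;q}$ be the $\mathfrak{sl}_2$-module with basis $v_\mu$, $\mu\in\lambda$, and action $$e v_\mu=\tfrac12\bigl(q-(\mu,\mu+2\rho)\bigr)v_{\mu+\alpha},\qquad h v_\mu=\mu(h)v_\mu,\qquad f v_\mu=v_{\mu-\alpha}.$$ Let $\widehat{\mathcal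 R}_{\lambda;q}$ be the relaxed Verma module induced from $\mathcal D_{\lambda;q}$, on which $x_0$ acts as $x$, $x_n$ ($n>0$) as $0$, $K$ as $\mathsf k$ and $L_0$ as $\Delta$. Let $\mathcal{E}_{\lambda;q}$ be the quotient of $\widehat{\mathcal R}_{\lambda;q}$ by the sum of all submodules that intersect the space of ground states $\mathcal D_{\lambda;q}$ trivially. For a module $\mathcal M$ let $\mathcal M(\mu,m)$ be the space of vectors of $\mathfrak{sl}_2$-weight $\mu$ and $L_0$-eigenvalue $m$, and let $\mathrm s_\mu[\mathcal M](\mathsf q)=\sum_{m\in\mathbb C}\dim\mathcal M(\mu,m)\,\mathsf q^m$ be its string functions. (i) All the spaces $\mathcal{E}_{\lambda;q}(\mu,m)$ are finite-dimensional, and the positive limiting string functions exist and do not depend on $\lambda$: there is a generalised formal power series $S=\sum_{m\in\mathbb C}a_m\mathsf q^m$ such that for every coset $\lambda$ and every $\mu\in\lambda$, $$\lim_{j\to\infty}\mathrm s_{\mu+j\alpha}[\mathcal{E}_{\lambda;q}]=S\qquad\text{(coefficientwise convergence).}$$ (ii) Call $\xi\in\mathfrak h^*$ generating if $\mathrm{Re}\,\xi>\mathrm{Re}\,\mu$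 for every $\mu\in\xi+\mathsf Q$ with $(\mu,\mu+2\rho)=q$. For every coset $\lambda$ and every generating $\xi\in\lambda$, there is exactly one bilinear form $\langle\cdot,\cdot\rangle$ on $\widehat{\mathcal R}_{\lambda;q}$ (the Shapovalov form) with $\langle v_\xi,v_\xi\rangle=1$ that is contravariant for the adjoint $e_n^\dagger=f_{-n}$, $h_n^\dagger=h_{-n}$, $f_n^\dagger=e_{-n}$, $K^\dagger=K$, $L_0^\dagger=L_0$. For $n\in\mathbb Z_{\ge0}$ let $P_n$ be the finite set of Poincar\'e--Birkhoff--Witt monomials in the $e_{-m},h_{-m},f_{-m}$ ($m>0$) and $f_0$, ordered so that mode indices increase to the right, that have conformal grade $n$ and $\mathfrak{sl}_2$-weight $-n\alpha$. Then, for each $n\in\mathbb Z_{\ge0}$, the rank of the Shapovalov matrix $$A_{\nu;n}=\bigl(\langle U v_{\nu+n\alpha},V v_{\nu+n\alpha}\rangle\bigr)_{U,V\in P_n}$$ is generically constant: it takes the same value for all but finitely many generating $\nu\in\mathfrak h^*$ (in particular for all $\nu$ with $\mathrm{Re}\,\nu$ sufficiently large), whatever the coset $\lambda$ of $\nu$ and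 whatever generating $\xi\in\lambda$ is used to normalise the form. -/

import Mathlib

noncomputable section

namespace RelaxedSl2

open scoped TensorProduct

attribute [local instance 100] LieRing.ofAssociativeRing

/-! ### The Lie algebra `sl₂` -/

/-- `sl₂(ℂ)`, the traceless complex `2 × 2` matrices. -/
abbrev sl2 : Type := LieAlgebra.SpecialLinear.sl (Fin 2) ℂ

/-- `e = E₀₁`. -/
def e : sl2 := LieAlgebra.SpecialLinear.single 0 1 (by decide) 1

/-- `f = E₁₀`. -/
def f : sl2 := LieAlgebra.SpecialLinear.single 1 0 (by decide) 1

/-- `h = E₀₀ - E₁₁`. -/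
def h : sl2 := LieAlgebra.SpecialLinear.singleSubSingle 0 1 1

/-- The rescaled Killing form `κ(x, y) = tr (x y)`: `κ(h, h) = 2`, `κ(e, f) = κ(f, e) = 1`. -/
def killing : LinearMap.BilinForm ℂ sl2 :=
  LinearMap.mk₂ ℂ (fun x y => Matrix.trace (x.1 * y.1))
    (by intros; simp [add_mul]) (by intros; simp)
    (by intros; simp [mul_add]) (by intros; simp)

lemma killing_apply (x y : sl2) : killing x y = Matrix.trace (x.1 * y.1) := rfl

lemma killing_symm : killing.IsSymm :=
  ⟨fun x y => by simp [killing_apply, Matrix.trace_mul_comm x.1 y.1]⟩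

lemma killing_lie (x y z : sl2) : killing ⁅x, y⁆ z = killing x ⁅y, z⁆ := by
  simp only [killing_apply, LieAlgebra.SpecialLinear.sl_bracket, sub_mul, mul_sub,
    Matrix.trace_sub, mul_assoc]
  congr 1
  rw [Matrix.trace_mul_comm, mul_assoc]

/-- The transpose on `sl₂`: `e ↦ f`, `h ↦ h`, `f ↦ e`. -/
def transpose : sl2 →ₗ[ℂ] sl2 where
  toFun x := ⟨x.1.transpose, by
    have hx : Matrix.trace x.1 = 0 := x.2
    change Matrix.trace x.1.transpose = 0
    rw [Matrix.trace_transpose, hx]⟩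
  map_add' x y := by ext; simp
  map_smul' c x := by ext; simp

/-! ### The affine Kac-Moody algebra `sl₂ ⊗ ℂ[t, t⁻¹] ⊕ ℂ K ⊕ ℂ L₀` -/

/-- The loop algebra `ℂ[t, t⁻¹] ⊗ sl₂` with its pointwise bracket. -/
abbrev Loop : Type := LieAlgebra.loopAlgebra ℂ ℤ sl2

/-- `x ⊗ tⁿ`, as a linear function of `x`. -/
def loopMode (n : ℤ) : sl2 →ₗ[ℂ] Loop :=
  TensorProduct.mk ℂ _ _ (AddMonoidAlgebra.single n (1 : ℂ))

/-- The coefficient of `tⁿ` of an element of the loop algebra. -/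
def loopCoeff (n : ℤ) : Loop →ₗ[ℂ] sl2 :=
  Finsupp.lapply n ∘ₗ (LieAlgebra.LoopAlgebra.toFinsupp ℂ ℤ sl2).toLinearMap

/-- The derivation `-t d/dt` of the loop algebra: `x ⊗ tⁿ ↦ -n x ⊗ tⁿ`. -/
def loopDeriv : Loop →ₗ[ℂ] Loop :=
  Finsupp.lsum ℂ (fun n : ℤ => (-n : ℂ) • loopMode n) ∘ₗ
    (LieAlgebra.LoopAlgebra.toFinsupp ℂ ℤ sl2).toLinearMap

/-- The cocycle `(x ⊗ tᵐ, y ⊗ tⁿ) ↦ m δ_{m+n,0} κ(x, y)`. -/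
def cocycle : LinearMap.BilinForm ℂ Loop :=
  -LieAlgebra.LoopAlgebra.residuePairing ℂ ℤ sl2 killing

lemma toFinsupp_loopMode (n : ℤ) (x : sl2) :
    LieAlgebra.LoopAlgebra.toFinsupp ℂ ℤ sl2 (loopMode n x) = Finsupp.single n x :=
  LieAlgebra.LoopAlgebra.toFinsupp_single_tmul ℂ ℤ sl2 n x

lemma loopCoeff_loopMode (m n : ℤ) (x : sl2) :
    loopCoeff m (loopMode n x) = if n = m then x else 0 := by
  simp only [loopCoeff, LinearMap.comp_apply, LinearEquiv.coe_coe, toFinsupp_loopMode,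
    Finsupp.lapply_apply, Finsupp.single_apply]

lemma loopDeriv_loopMode (n : ℤ) (x : sl2) :
    loopDeriv (loopMode n x) = (-n : ℂ) • loopMode n x := by
  simp only [loopDeriv, LinearMap.comp_apply, LinearEquiv.coe_coe, toFinsupp_loopMode]
  simp [-neg_smul]

lemma cocycle_loopMode (m n : ℤ) (x y : sl2) :
    cocycle (loopMode m x) (loopMode n y) = if m + n = 0 then (m : ℂ) * killing x y else 0 := by
  simp only [cocycle, LinearMap.neg_apply, LieAlgebra.LoopAlgebra.residuePairing_apply_apply,
    toFinsupp_loopMode, Finsupp.single_apply]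
  by_cases hmn : m + n = 0
  · obtain rfl : n = -m := by omega
    simp
  · have : m ≠ -n := by omega
    simp [hmn, this]

lemma loopMode_lie (m n : ℤ) (x y : sl2) :
    ⁅loopMode m x, loopMode n y⁆ = loopMode (m + n) ⁅x, y⁆ := by
  simp only [loopMode, TensorProduct.mk_apply, LieAlgebra.ExtendScalars.bracket_tmul,
    AddMonoidAlgebra.single_mul_single, mul_one]

lemma loop_add_lie (x y z : Loop) : ⁅x + y, z⁆ = ⁅x, z⁆ + ⁅y, z⁆ := add_lie x y z
lemma loop_lie_add (x y z : Loop) : ⁅x, y + z⁆ = ⁅x, y⁆ + ⁅x, z⁆ := lie_add x y z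
lemma loop_sub_lie (x y z : Loop) : ⁅x - y, z⁆ = ⁅x, z⁆ - ⁅y, z⁆ := sub_lie x y z
lemma loop_lie_sub (x y z : Loop) : ⁅x, y - z⁆ = ⁅x, y⁆ - ⁅x, z⁆ := lie_sub x y z
lemma loop_zero_lie (x : Loop) : ⁅(0 : Loop), x⁆ = 0 := zero_lie x
lemma loop_lie_zero (x : Loop) : ⁅x, (0 : Loop)⁆ = 0 := lie_zero x
lemma loop_smul_lie (c : ℂ) (x y : Loop) : ⁅c • x, y⁆ = c • ⁅x, y⁆ := smul_lie c x y
lemma loop_lie_smul (c : ℂ) (x y : Loop) : ⁅x, c • y⁆ = c • ⁅x, y⁆ := lie_smul c x y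
lemma loop_lie_self (x : Loop) : ⁅x, x⁆ = 0 := lie_self x
lemma loop_lie_skew (x y : Loop) : ⁅x, y⁆ = -⁅y, x⁆ := (lie_skew x y).symm
lemma loop_leibniz (x y z : Loop) : ⁅x, ⁅y, z⁆⁆ = ⁅⁅x, y⁆, z⁆ + ⁅y, ⁅x, z⁆⁆ :=
  LieRing.leibniz_lie x y z

lemma loop_induction {p : Loop → Prop} (h0 : p 0) (hadd : ∀ x y, p x → p y → p (x + y))
    (hmode : ∀ n x, p (loopMode n x)) (x : Loop) : p x := by
  have key : ∀ y : ℤ →₀ sl2, p ((LieAlgebra.LoopAlgebra.toFinsupp ℂ ℤ sl2).symm y) := by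
    intro y
    induction y using Finsupp.induction_linear with
    | zero => rw [map_zero]; exact h0
    | add y z hy hz => rw [map_add]; exact hadd _ _ hy hz
    | single n x => rw [← toFinsupp_loopMode, LinearEquiv.symm_apply_apply]; exact hmode n x
  have hx := key (LieAlgebra.LoopAlgebra.toFinsupp ℂ ℤ sl2 x)
  rwa [LinearEquiv.symm_apply_apply] at hx

lemma loopDeriv_lie (x y : Loop) : loopDeriv ⁅x, y⁆ = ⁅loopDeriv x, y⁆ + ⁅x, loopDeriv y⁆ := by
  induction x using loop_induction with
  | h0 => simp only [loop_zero_lie, map_zero, add_zero]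
  | hadd x x' hx hx' => simp only [loop_add_lie, map_add, hx, hx']; abel
  | hmode m x =>
    induction y using loop_induction with
    | h0 => simp only [loop_lie_zero, map_zero, add_zero]
    | hadd y y' hy hy' => simp only [loop_lie_add, map_add, hy, hy']; abel
    | hmode n y =>
      simp only [loopMode_lie, loopDeriv_loopMode, loop_smul_lie, loop_lie_smul, ← add_smul]
      push_cast
      ring_nf

lemma cocycle_self (x : Loop) : cocycle x x = 0 := by
  have h1 : TrivialLieModule.equiv ℂ Loop ℂ _ = TrivialLieModule.equiv ℂ Loop ℂ 0 :=
    congrArg _ (LieModule.Cohomology.mem_twoCochain_iff.mp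
      (LieAlgebra.LoopAlgebra.twoCochainOfBilinear ℂ ℤ sl2 killing killing_symm).2 x)
  have h2 : LieAlgebra.LoopAlgebra.residuePairing ℂ ℤ sl2 killing x x = 0 := h1
  rw [cocycle, LinearMap.neg_apply, LinearMap.neg_apply, h2, neg_zero]

lemma cocycle_skew (x y : Loop) : cocycle x y = -cocycle y x := by
  have := cocycle_self (x + y)
  simp only [map_add, LinearMap.add_apply, cocycle_self] at this
  linear_combination this

lemma cocycle_loopDeriv (x y : Loop) :
    cocycle (loopDeriv x) y + cocycle x (loopDeriv y) = 0 := by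
  induction x using loop_induction with
  | h0 => simp only [map_zero, LinearMap.zero_apply, add_zero]
  | hadd x x' hx hx' =>
    simp only [map_add, LinearMap.add_apply]; linear_combination hx + hx'
  | hmode m x =>
    induction y using loop_induction with
    | h0 => simp only [map_zero, add_zero]
    | hadd y y' hy hy' =>
      simp only [map_add]; linear_combination hy + hy'
    | hmode n y =>
      simp only [loopDeriv_loopMode, map_smul, LinearMap.smul_apply, cocycle_loopMode]
      split_ifs with hmn
      · obtain rfl : n = -m := by omega
        simp
      · simp

lemma cocycle_jacobi (x y z : Loop) :
    cocycle x ⁅y, z⁆ = cocycle ⁅x, y⁆ z + cocycle y ⁅x, z⁆ := by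
  induction x using loop_induction with
  | h0 => simp only [loop_zero_lie, map_zero, LinearMap.zero_apply, add_zero]
  | hadd x x' hx hx' =>
    simp only [map_add, LinearMap.add_apply, loop_add_lie]; linear_combination hx + hx'
  | hmode a x =>
    induction y using loop_induction with
    | h0 => simp only [loop_zero_lie, loop_lie_zero, map_zero, LinearMap.zero_apply, add_zero]
    | hadd y y' hy hy' =>
      simp only [map_add, LinearMap.add_apply, loop_add_lie, loop_lie_add]; linear_combination hy + hy'
    | hmode b y =>
      induction z using loop_induction with
      | h0 => simp only [loop_lie_zero, map_zero, add_zero]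
      | hadd z z' hz hz' =>
        simp only [map_add, loop_lie_add]; linear_combination hz + hz'
      | hmode c z =>
        simp only [loopMode_lie, cocycle_loopMode]
        have h1 : killing ⁅x, y⁆ z = killing x ⁅y, z⁆ := killing_lie x y z
        have h2 : killing y ⁅x, z⁆ = -killing x ⁅y, z⁆ := by
          rw [← killing_lie, ← lie_skew, map_neg, LinearMap.neg_apply, h1]
        have e1 : a + (b + c) = a + b + c := by ring
        have e2 : b + (a + c) = a + b + c := by ring
        rw [e1, e2, h1, h2]
        split_ifs with habc
        · push_cast; ring
        · simp

/-- The affine Kac-Moody algebra: `loop + central K + deriv L₀`. -/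
@[ext] structure Affine where
  /-- the component in `sl₂ ⊗ ℂ[t, t⁻¹]` -/
  loop : Loop
  /-- the coefficient of `K` -/
  central : ℂ
  /-- the coefficient of `L₀` -/
  deriv : ℂ

namespace Affine

/-- The underlying vector space. -/
def equivProd : Affine ≃ Loop × ℂ × ℂ where
  toFun x := (x.loop, x.central, x.deriv)
  invFun x := ⟨x.1, x.2.1, x.2.2⟩
  left_inv _ := rfl
  right_inv _ := rfl

instance : AddCommGroup Affine := equivProd.addCommGroup

instance : Module ℂ Affine := equivProd.module ℂ

@[simp] lemma loop_zero : (0 : Affine).loop = 0 := rfl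
@[simp] lemma central_zero : (0 : Affine).central = 0 := rfl
@[simp] lemma deriv_zero : (0 : Affine).deriv = 0 := rfl
@[simp] lemma loop_add (x y : Affine) : (x + y).loop = x.loop + y.loop := rfl
@[simp] lemma central_add (x y : Affine) : (x + y).central = x.central + y.central := rfl
@[simp] lemma deriv_add (x y : Affine) : (x + y).deriv = x.deriv + y.deriv := rfl
@[simp] lemma loop_smul (c : ℂ) (x : Affine) : (c • x).loop = c • x.loop := rfl
@[simp] lemma central_smul (c : ℂ) (x : Affine) : (c • x).central = c * x.central := rfl
@[simp] lemma deriv_smul (c : ℂ) (x : Affine) : (c • x).deriv = c * x.deriv := rfl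

/-- `[x_m, y_n] = [x, y]_{m+n} + m δ_{m+n,0} κ(x, y) K`, `[L₀, x_n] = -n x_n`, `K` central. -/
instance : Bracket Affine Affine where
  bracket x y :=
    ⟨⁅x.loop, y.loop⁆ + x.deriv • loopDeriv y.loop - y.deriv • loopDeriv x.loop,
      cocycle x.loop y.loop, 0⟩

@[simp] lemma loop_lie (x y : Affine) : ⁅x, y⁆.loop =
    ⁅x.loop, y.loop⁆ + x.deriv • loopDeriv y.loop - y.deriv • loopDeriv x.loop := rfl
@[simp] lemma central_lie (x y : Affine) : ⁅x, y⁆.central = cocycle x.loop y.loop := rfl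
@[simp] lemma deriv_lie (x y : Affine) : ⁅x, y⁆.deriv = 0 := rfl

instance : LieRing Affine where
  add_lie x y z := by
    ext1
    · simp [add_smul, loop_add_lie]; abel
    · simp
    · simp
  lie_add x y z := by
    ext1
    · simp [add_smul, loop_lie_add]; abel
    · simp
    · simp
  lie_self x := by
    ext1
    · simp
    · simp [cocycle_self]
    · simp
  leibniz_lie x y z := by
    ext1
    · simp only [loop_lie, loop_add, deriv_lie, loopDeriv_lie, map_add, map_sub, map_smul,
        loop_lie_add, loop_lie_sub, loop_add_lie, loop_sub_lie, loop_lie_smul, loop_smul_lie, smul_add, smul_sub, zero_smul,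
        loop_leibniz x.loop y.loop z.loop]
      rw [loop_lie_skew y.loop (loopDeriv x.loop), smul_comm x.deriv y.deriv, 
        smul_comm x.deriv z.deriv, smul_comm y.deriv z.deriv]
      simp only [smul_neg]
      abel
    · simp only [loop_lie, central_lie, central_add, map_add, map_sub, map_smul,
        LinearMap.add_apply, LinearMap.sub_apply, LinearMap.smul_apply, smul_eq_mul,
        cocycle_jacobi x.loop y.loop z.loop]
      have h1 := cocycle_loopDeriv x.loop y.loop
      have h2 := cocycle_loopDeriv x.loop z.loop
      have h3 := cocycle_loopDeriv y.loop z.loop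
      have h4 := cocycle_skew y.loop (loopDeriv x.loop)
      linear_combination y.deriv * h2 - z.deriv * h1 - x.deriv * h3 + z.deriv * h4
    · simp

instance : LieAlgebra ℂ Affine where
  lie_smul c x y := by
    ext1
    · simp [smul_sub, mul_smul, smul_comm c x.deriv, loop_lie_smul]
    · simp
    · simp

/-- The element `x_n = x ⊗ tⁿ`, as a linear function of `x`. -/
def mode (n : ℤ) : sl2 →ₗ[ℂ] Affine where
  toFun x := ⟨loopMode n x, 0, 0⟩
  map_add' x y := by ext1 <;> simp
  map_smul' c x := by ext1 <;> simp

/-- The central element `K`. -/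
def K : Affine := ⟨0, 1, 0⟩

/-- The derivation `L₀`. -/
def L0 : Affine := ⟨0, 0, 1⟩

lemma mode_lie_mode (m n : ℤ) (x y : sl2) : ⁅mode m x, mode n y⁆ =
    mode (m + n) ⁅x, y⁆ + if m + n = 0 then ((m : ℂ) * killing x y) • K else 0 := by
  ext1
  · by_cases hmn : m + n = 0 <;> simp [mode, loopMode_lie, K, hmn]
  · by_cases hmn : m + n = 0 <;> simp [mode, cocycle_loopMode, K, hmn]
  · by_cases hmn : m + n = 0 <;> simp [mode, K, hmn]

lemma L0_lie_mode (n : ℤ) (x : sl2) : ⁅L0, mode n x⁆ = (-n : ℂ) • mode n x := by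
  ext1
  · simp [mode, L0, loopDeriv_loopMode, loop_zero_lie, -neg_smul]
  · simp [mode, L0, -neg_smul]
  · simp [mode, L0, -neg_smul]

lemma K_lie (x : Affine) : ⁅K, x⁆ = 0 := by
  ext1
  · simp [K, loop_zero_lie]
  · simp [K]
  · simp [K]

/-- The adjoint `x_n ↦ (xᵀ)_{-n}`, `K ↦ K`, `L₀ ↦ L₀`; thus `e_n ↦ f_{-n}`, `h_n ↦ h_{-n}`,
`f_n ↦ e_{-n}`. -/
def dagger : Affine →ₗ[ℂ] Affine where
  toFun x := ⟨Finsupp.lsum ℂ (fun n : ℤ => loopMode (-n) ∘ₗ transpose)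
    (LieAlgebra.LoopAlgebra.toFinsupp ℂ ℤ sl2 x.loop), x.central, x.deriv⟩
  map_add' x y := by
    ext1
    · simp only [loop_add, map_add]
    · rfl
    · rfl
  map_smul' c x := by
    ext1
    · simp only [loop_smul, map_smul, RingHom.id_apply]
    · rfl
    · rfl

lemma dagger_mode (n : ℤ) (x : sl2) : dagger (mode n x) = mode (-n) (transpose x) := by
  ext1
  · simp only [dagger, mode, LinearMap.coe_mk, AddHom.coe_mk, toFinsupp_loopMode]
    simp
  · rfl
  · rfl

lemma loopCoeff_lie (n : ℤ) (x y : Loop) : loopCoeff n ⁅x, y⁆ =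
    (LieAlgebra.LoopAlgebra.toFinsupp ℂ ℤ sl2 x).sum fun m a => ⁅a, loopCoeff (n - m) y⁆ := by
  induction x using loop_induction with
  | h0 => simp only [loop_zero_lie, map_zero, Finsupp.sum_zero_index]
  | hadd x x' hx hx' =>
    rw [loop_add_lie, map_add, map_add, hx, hx', Finsupp.sum_add_index'] <;> simp
  | hmode m x =>
    rw [toFinsupp_loopMode, Finsupp.sum_single_index (by simp)]
    induction y using loop_induction with
    | h0 => simp only [loop_lie_zero, map_zero, lie_zero]
    | hadd y y' hy hy' => rw [loop_lie_add, map_add, map_add, hy, hy', lie_add]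
    | hmode k y =>
      rw [loopMode_lie, loopCoeff_loopMode, loopCoeff_loopMode]
      by_cases hk : k = n - m
      · rw [if_pos hk, if_pos (by omega)]
      · rw [if_neg hk, if_neg (by omega), lie_zero]

lemma loopCoeff_loopDeriv (n : ℤ) (x : Loop) :
    loopCoeff n (loopDeriv x) = (-n : ℂ) • loopCoeff n x := by
  induction x using loop_induction with
  | h0 => simp
  | hadd x x' hx hx' => simp only [map_add, hx, hx', smul_add]
  | hmode m x =>
    rw [loopDeriv_loopMode, map_smul, loopCoeff_loopMode]
    split_ifs with hm
    · rw [hm]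
    · simp

/-- The subalgebra spanned by `K`, `L₀` and the `x_n` with `n ≥ 0`. -/
def nonneg : LieSubalgebra ℂ Affine where
  carrier := {x | ∀ n < 0, loopCoeff n x.loop = 0}
  zero_mem' := by intro n _; simp
  add_mem' := by
    intro x y hx hy n hn
    rw [loop_add, map_add, hx n hn, hy n hn, add_zero]
  smul_mem' := by
    intro c x hx n hn
    rw [loop_smul, map_smul, hx n hn, smul_zero]
  lie_mem' := by
    intro x y hx hy n hn
    have h0 : loopCoeff n ⁅x.loop, y.loop⁆ = 0 := by
      rw [loopCoeff_lie]
      refine Finset.sum_eq_zero fun m _ => ?_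
      by_cases hm : m < 0
      · have : LieAlgebra.LoopAlgebra.toFinsupp ℂ ℤ sl2 x.loop m = 0 := hx m hm
        simp only [this, zero_lie]
      · simp only [hy (n - m) (by omega), lie_zero]
    rw [loop_lie, map_sub, map_add, map_smul, map_smul, h0, loopCoeff_loopDeriv,
      loopCoeff_loopDeriv, hx n hn, hy n hn]
    simp

lemma loopCoeff_zero_lie {x y : Affine} (hx : x ∈ nonneg) (hy : y ∈ nonneg) :
    loopCoeff 0 ⁅x, y⁆.loop = ⁅loopCoeff 0 x.loop, loopCoeff 0 y.loop⁆ := by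
  have h0 : loopCoeff 0 ⁅x.loop, y.loop⁆ = ⁅loopCoeff 0 x.loop, loopCoeff 0 y.loop⁆ := by
    rw [loopCoeff_lie, Finsupp.sum, Finset.sum_eq_single 0]
    · rfl
    · intro m _ hm
      rcases lt_or_gt_of_ne hm with hm | hm
      · have : LieAlgebra.LoopAlgebra.toFinsupp ℂ ℤ sl2 x.loop m = 0 := hx m hm
        rw [this, zero_lie]
      · rw [hy (0 - m) (by omega), lie_zero]
    · intro hm
      rw [Finsupp.notMem_support_iff.mp hm, zero_lie]
  rw [loop_lie, map_sub, map_add, map_smul, map_smul, h0, loopCoeff_loopDeriv,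
    loopCoeff_loopDeriv]
  simp

lemma cocycle_nonneg {x y : Affine} (hx : x ∈ nonneg) (hy : y ∈ nonneg) :
    cocycle x.loop y.loop = 0 := by
  rw [cocycle, LinearMap.neg_apply, LinearMap.neg_apply,
    LieAlgebra.LoopAlgebra.residuePairing_apply_apply, neg_eq_zero]
  refine Finset.sum_eq_zero fun m _ => ?_
  rcases lt_trichotomy m 0 with hm | hm | hm
  · have : LieAlgebra.LoopAlgebra.toFinsupp ℂ ℤ sl2 y.loop m = 0 := hy m hm
    simp [this]
  · simp [hm]
  · have : LieAlgebra.LoopAlgebra.toFinsupp ℂ ℤ sl2 x.loop (-m) = 0 := hx (-m) (by omega)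
    simp [this]

end Affine

/-! ### Dense `sl₂`-modules

Weights `μ ∈ 𝔥*` are identified with `μ(h) ∈ ℂ`.  Then the simple root is `2`, the root lattice is
`2ℤ`, and the pairing normalised by `(α, α) = 2` is `(μ, ν) = μ ν / 2`. -/

/-- `𝔥*` modulo the root lattice. -/
abbrev WeightCoset : Type := ℂ ⧸ AddSubgroup.zmultiples (2 : ℂ)

/-- The weights belonging to a given coset. -/
def CosetWeight (lam : WeightCoset) : Type := {mu : ℂ // (mu : WeightCoset) = lam}

namespace CosetWeight

variable {lam : WeightCoset}

/-- The weight, as a complex number. -/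
def val (mu : CosetWeight lam) : ℂ := mu.1

/-- `μ + m α`. -/
def shift (mu : CosetWeight lam) (m : ℤ) : CosetWeight lam :=
  ⟨mu.val + m * 2, by
    refine Eq.trans ?_ mu.2
    rw [QuotientAddGroup.eq]
    exact ⟨-m, by simp [val]⟩⟩

@[simp] lemma val_shift (mu : CosetWeight lam) (m : ℤ) : (mu.shift m).val = mu.val + m * 2 := rfl

@[ext] lemma ext {mu nu : CosetWeight lam} (hv : mu.val = nu.val) : mu = nu := Subtype.ext hv

@[simp] lemma shift_shift (mu : CosetWeight lam) (m n : ℤ) :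
    (mu.shift m).shift n = mu.shift (m + n) := by
  ext; simp; ring

@[simp] lemma shift_zero (mu : CosetWeight lam) : mu.shift 0 = mu := by
  ext; simp

end CosetWeight

/-- `(μ, μ + 2 ρ)`, where `ρ` is the Weyl vector. -/
def casimirValue (mu : ℂ) : ℂ := mu * (mu + 2) / 2

/-- The underlying space of the dense module: it has basis `v_μ`, `μ ∈ λ`. -/
abbrev Dense (lam : WeightCoset) : Type := CosetWeight lam →₀ ℂ

section Dense

variable (q : ℂ) (lam : WeightCoset)

/-- `e v_μ = γ_μ v_{μ+α}`, where `γ_μ = (q - (μ, μ + 2 ρ)) / 2`. -/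
def denseE : Module.End ℂ (Dense lam) :=
  Finsupp.linearCombination ℂ fun mu : CosetWeight lam =>
    Finsupp.single (mu.shift 1) ((q - casimirValue mu.val) / 2)

/-- `h v_μ = μ(h) v_μ`. -/
def denseH : Module.End ℂ (Dense lam) :=
  Finsupp.linearCombination ℂ fun mu : CosetWeight lam => Finsupp.single mu mu.val

/-- `f v_μ = v_{μ-α}`. -/
def denseF : Module.End ℂ (Dense lam) :=
  Finsupp.linearCombination ℂ fun mu : CosetWeight lam => Finsupp.single (mu.shift (-1)) 1

lemma dense_HE : denseH lam * denseE q lam = denseE q lam * denseH lam + (2 : ℂ) • denseE q lam := by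
  ext mu : 2
  simp only [denseH, denseE, Module.End.mul_apply, LinearMap.comp_apply,
    LinearMap.add_apply, LinearMap.smul_apply, Finsupp.lsingle_apply,
    Finsupp.linearCombination_single, Finsupp.smul_single, smul_eq_mul, one_mul,
    CosetWeight.val_shift, ← Finsupp.single_add]
  congr 1
  push_cast
  ring

lemma dense_HF : denseH lam * denseF lam = denseF lam * denseH lam - (2 : ℂ) • denseF lam := by
  ext mu : 2
  simp only [denseH, denseF, Module.End.mul_apply, LinearMap.comp_apply,
    LinearMap.sub_apply, LinearMap.smul_apply, Finsupp.lsingle_apply,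
    Finsupp.linearCombination_single, Finsupp.smul_single, smul_eq_mul, one_mul,
    CosetWeight.val_shift, ← Finsupp.single_sub]
  congr 1
  push_cast
  ring

lemma dense_EF : denseE q lam * denseF lam = denseF lam * denseE q lam + denseH lam := by
  ext mu : 2
  simp [denseH, denseE, denseF, casimirValue, ← Finsupp.single_add]
  ring_nf

/-- The `sl₂`-module `D_{λ;q}`, with `x = x₀₀ h + x₀₁ e + x₁₀ f` acting as above. -/
def denseRep : sl2 →ₗ⁅ℂ⁆ Module.End ℂ (Dense lam) where
  toFun x := x.1 0 0 • denseH lam + x.1 0 1 • denseE q lam + x.1 1 0 • denseF lam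
  map_add' x y := by
    have hxy : ∀ i j, (x + y).1 i j = x.1 i j + y.1 i j := fun i j => rfl
    simp only [hxy, add_smul]; abel
  map_smul' c x := by
    simp [smul_smul]
  map_lie' {x y} := by
    have tr : ∀ z : sl2, z.1 1 1 = -z.1 0 0 := fun z => by
      have hz : Matrix.trace z.1 = 0 := z.2
      rw [Matrix.trace_fin_two] at hz
      linear_combination hz
    have e00 : (⁅x, y⁆ : sl2).1 0 0 = x.1 0 1 * y.1 1 0 - y.1 0 1 * x.1 1 0 := by
      rw [LieAlgebra.SpecialLinear.sl_bracket, Matrix.sub_apply, Matrix.mul_apply,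
        Matrix.mul_apply, Fin.sum_univ_two, Fin.sum_univ_two]
      ring
    have e01 : (⁅x, y⁆ : sl2).1 0 1 = 2 * (x.1 0 0 * y.1 0 1 - y.1 0 0 * x.1 0 1) := by
      rw [LieAlgebra.SpecialLinear.sl_bracket, Matrix.sub_apply, Matrix.mul_apply,
        Matrix.mul_apply, Fin.sum_univ_two, Fin.sum_univ_two, tr x, tr y]
      ring
    have e10 : (⁅x, y⁆ : sl2).1 1 0 = 2 * (x.1 1 0 * y.1 0 0 - y.1 1 0 * x.1 0 0) := by
      rw [LieAlgebra.SpecialLinear.sl_bracket, Matrix.sub_apply, Matrix.mul_apply,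
        Matrix.mul_apply, Fin.sum_univ_two, Fin.sum_univ_two, tr x, tr y]
      ring
    simp only [e00, e01, e10, Ring.lie_def, mul_add, add_mul, smul_mul_assoc, mul_smul_comm,
      dense_HE, dense_HF, dense_EF]
    module

end Dense

/-! ### Induced modules -/

/-- The relations `u y ⊗ v = u ⊗ y v`, `y ∈ P`, of `U(L) ⊗_{U(P)} V` inside `U(L) ⊗_ℂ V`. -/
def inducedRelations {L V : Type} [LieRing L] [LieAlgebra ℂ L] [AddCommGroup V] [Module ℂ V]
    (P : LieSubalgebra ℂ L) (ρ : P →ₗ⁅ℂ⁆ Module.End ℂ V) :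
    Submodule (UniversalEnvelopingAlgebra ℂ L) (UniversalEnvelopingAlgebra ℂ L ⊗[ℂ] V) :=
  Submodule.span _ {z | ∃ (u : UniversalEnvelopingAlgebra ℂ L) (y : P) (v : V),
    z = (u * UniversalEnvelopingAlgebra.ι ℂ (y : L)) ⊗ₜ[ℂ] v - u ⊗ₜ[ℂ] ρ y v}

/-- The induced module `U(L) ⊗_{U(P)} V`. -/
abbrev Induced {L V : Type} [LieRing L] [LieAlgebra ℂ L] [AddCommGroup V] [Module ℂ V]
    (P : LieSubalgebra ℂ L) (ρ : P →ₗ⁅ℂ⁆ Module.End ℂ V) : Type :=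
  (UniversalEnvelopingAlgebra ℂ L ⊗[ℂ] V) ⧸ inducedRelations P ρ

/-! ### Relaxed Verma modules and their quotients -/

/-- The universal enveloping algebra of the affine algebra. -/
abbrev U : Type := UniversalEnvelopingAlgebra ℂ Affine

/-- The inclusion of the affine algebra in its universal enveloping algebra. -/
abbrev iota : Affine →ₗ⁅ℂ⁆ U := UniversalEnvelopingAlgebra.ι ℂ

section Relaxed

variable (k Δ q : ℂ) (lam : WeightCoset)

/-- The action of the nonnegative subalgebra on `D_{λ;q}`: `x_0` acts as `x`, the `x_n` with
`n > 0` act as `0`, `K` acts as the level `k` and `L₀` as the conformal weight `Δ`. -/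
def groundRep : Affine.nonneg →ₗ⁅ℂ⁆ Module.End ℂ (Dense lam) where
  toFun x := denseRep q lam (loopCoeff 0 x.1.loop) + (k * x.1.central + Δ * x.1.deriv) • 1
  map_add' x y := by
    have h1 : (x + y).1.loop = x.1.loop + y.1.loop := rfl
    have h2 : (x + y).1.central = x.1.central + y.1.central := rfl
    have h3 : (x + y).1.deriv = x.1.deriv + y.1.deriv := rfl
    simp only [h1, h2, h3, map_add]
    module
  map_smul' c x := by
    have h1 : (c • x).1.loop = c • x.1.loop := rfl
    have h2 : (c • x).1.central = c * x.1.central := rfl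
    have h3 : (c • x).1.deriv = c * x.1.deriv := rfl
    simp only [h1, h2, h3, map_smul, RingHom.id_apply]
    module
  map_lie' {x y} := by
    have hc : (⁅x, y⁆ : Affine.nonneg).1.central = 0 := by
      change cocycle x.1.loop y.1.loop = 0
      exact Affine.cocycle_nonneg x.2 y.2
    have hl : loopCoeff 0 (⁅x, y⁆ : Affine.nonneg).1.loop =
        ⁅loopCoeff 0 x.1.loop, loopCoeff 0 y.1.loop⁆ := Affine.loopCoeff_zero_lie x.2 y.2
    have hd : (⁅x, y⁆ : Affine.nonneg).1.deriv = 0 := rfl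
    rw [hl, hc, hd, LieHom.map_lie]
    simp only [Ring.lie_def, mul_add, add_mul, mul_smul_comm, smul_mul_assoc, mul_one, one_mul]
    module

/-- The relaxed Verma module `R̂_{λ;q}` of level `k` and conformal weight `Δ`, as a module over
the universal enveloping algebra. -/
abbrev RelaxedVerma : Type := Induced Affine.nonneg (groundRep k Δ q lam)

/-- The canonical map from `D_{λ;q}` onto the ground states of the relaxed Verma module. -/
def groundMap : Dense lam →ₗ[ℂ] RelaxedVerma k Δ q lam :=
  ((inducedRelations Affine.nonneg (groundRep k Δ q lam)).mkQ.restrictScalars ℂ) ∘ₗ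
    TensorProduct.mk ℂ U (Dense lam) 1

/-- The sum of all submodules of the relaxed Verma module that intersect the space of ground
states trivially. -/
def groundFree : Submodule U (RelaxedVerma k Δ q lam) :=
  sSup {N | N.restrictScalars ℂ ⊓ LinearMap.range (groundMap k Δ q lam) = ⊥}

/-- The relaxed highest-weight module `E_{λ;q}`. -/
abbrev RelaxedModule : Type := RelaxedVerma k Δ q lam ⧸ groundFree k Δ q lam

variable {k Δ q lam}

/-- The ground state `v_μ` of the relaxed Verma module. -/
def groundState (mu : CosetWeight lam) : RelaxedVerma k Δ q lam :=
  groundMap k Δ q lam (Finsupp.single mu 1)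

end Relaxed

/-! ### Weight spaces and string functions -/

section Weights

variable (M : Type) [AddCommGroup M] [Module ℂ M] [Module U M] [IsScalarTower ℂ U M]

/-- The space of vectors of `sl₂`-weight `μ` and conformal weight `n`. -/
def weightSpace (mu n : ℂ) : Submodule ℂ M :=
  Module.End.eigenspace (Algebra.lsmul ℂ ℂ M (iota (Affine.mode 0 h))) mu ⊓
    Module.End.eigenspace (Algebra.lsmul ℂ ℂ M (iota Affine.L0)) n

/-- The string function `s_μ[M](q) = ∑_n dim M(μ, n) qⁿ`, a generalised formal power series in
`q` with exponents in `ℂ`, given by its coefficients. -/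
def stringFunction (mu : ℂ) : ℂ → ℕ := fun n => Module.finrank ℂ (weightSpace M mu n)

/-- `S` is the positive limiting string function of `M`, whose weights lie in the coset `λ`: for
each base weight `μ ∈ λ` and each exponent `n`, the coefficients of `qⁿ` in the string functions
of weight `μ + m α` converge to that of `S` as `m → ∞`. -/
def IsPositiveLimitingStringFunction (lam : WeightCoset) (S : ℂ → ℕ) : Prop :=
  ∀ (mu : CosetWeight lam) (n : ℂ),
    Filter.Tendsto (fun m : ℤ => stringFunction M (mu.shift m).val n) Filter.atTop (nhds (S n))

end Weights

/-! ### Shapovalov forms and matrices -/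

/-- The weights `ξ` whose ground state `v_ξ` is used as a cyclic generator: `ξ` is larger (for the
real part) than every solution `μ ∈ [ξ]` of `(μ, μ + 2 ρ) = q`.  There is no condition if the
coset of `ξ` contains no solution.  For fixed `q` every weight of sufficiently large real part
qualifies. -/
def IsGenerating (q : ℂ) {lam : WeightCoset} (xi : CosetWeight lam) : Prop :=
  ∀ mu : CosetWeight lam, casimirValue mu.val = q → mu.val.re < xi.val.re

section Shapovalov

variable {k Δ q : ℂ} {lam : WeightCoset}

/-- `B` is the Shapovalov form on the relaxed Verma module with respect to the ground state `v_ξ`: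
the contravariant bilinear form with `⟨v_ξ, v_ξ⟩ = 1`. -/
structure IsShapovalovForm (B : LinearMap.BilinForm ℂ (RelaxedVerma k Δ q lam))
    (xi : CosetWeight lam) : Prop where
  normalised : B (groundState xi) (groundState xi) = 1
  contravariant : ∀ (x : Affine) (u w : RelaxedVerma k Δ q lam),
    B (iota x • u) w = B u (iota (Affine.dagger x) • w)

end Shapovalov

/-- The exponents of the Poincaré-Birkhoff-Witt monomials of conformal grade `n` and
`sl₂`-weight `-n α` in the modes of index `≤ 0` in which `e_0` and `h_0` do not occur. The entries
`expE i`, `expH i`, `expF i` are the exponents of `e_{-(i+1)}`, `h_{-(i+1)}`, `f_{-(i+1)}` and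
`expF0` is that of `f_0`; the modes of index `< -n` cannot occur. -/
@[ext] structure PBW (n : ℕ) where
  expE : Fin n → ℕ
  expH : Fin n → ℕ
  expF : Fin n → ℕ
  expF0 : ℕ
  grade : ∑ i : Fin n, (i.1 + 1) * (expE i + expH i + expF i) = n
  weight : ∑ i : Fin n, ((expE i : ℤ) - expF i) - expF0 = -n

namespace PBW

variable {n : ℕ}

/-- The monomial itself, with mode indices increasing to the right. -/
def monomial (P : PBW n) : U :=
  ((List.finRange n).reverse.map fun i : Fin n =>
      iota (Affine.mode (-(i.1 + 1 : ℤ)) e) ^ P.expE i *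
      iota (Affine.mode (-(i.1 + 1 : ℤ)) h) ^ P.expH i *
      iota (Affine.mode (-(i.1 + 1 : ℤ)) f) ^ P.expF i).prod *
    iota (Affine.mode 0 f) ^ P.expF0

lemma exp_le (P : PBW n) (i : Fin n) : P.expE i + P.expH i + P.expF i ≤ n := by
  have h1 : (i.1 + 1) * (P.expE i + P.expH i + P.expF i) ≤ n := by
    conv_rhs => rw [← P.grade]
    exact Finset.single_le_sum
      (f := fun i : Fin n => (i.1 + 1) * (P.expE i + P.expH i + P.expF i))
      (fun _ _ => Nat.zero_le _) (Finset.mem_univ i)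
  nlinarith [Nat.zero_le (i.1 * (P.expE i + P.expH i + P.expF i))]

instance : Finite (PBW n) := by
  refine Finite.of_injective (fun P : PBW n => (
    (fun i => ⟨P.expE i, by have := P.exp_le i; omega⟩ : Fin n → Fin (n + 1)),
    (fun i => ⟨P.expH i, by have := P.exp_le i; omega⟩ : Fin n → Fin (n + 1)),
    (fun i => ⟨P.expF i, by have := P.exp_le i; omega⟩ : Fin n → Fin (n + 1)))) ?_
  intro P Q hPQ
  simp only [Prod.mk.injEq, funext_iff, Fin.mk.injEq] at hPQ
  obtain ⟨hE, hH, hF⟩ := hPQ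
  have hw := P.weight
  have hw' := Q.weight
  simp only [hE, hF] at hw
  refine PBW.ext (funext hE) (funext hH) (funext hF) ?_
  omega

instance : Fintype (PBW n) := Fintype.ofFinite _

end PBW

/-- The Shapovalov matrix `A_{ν;n}` with entries `⟨U v_{ν+nα}, V v_{ν+nα}⟩`, where `U` and `V` run
over the monomials above; the vectors `U v_{ν+nα}` span the weight space of `sl₂`-weight `ν` and
conformal weight `Δ + n` of the relaxed Verma module. -/
def shapovalovMatrix {k Δ q : ℂ} {lam : WeightCoset}
    (B : LinearMap.BilinForm ℂ (RelaxedVerma k Δ q lam)) (nu : CosetWeight lam) (n : ℕ) :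
    Matrix (PBW n) (PBW n) ℂ :=
  Matrix.of fun P Q =>
    B (P.monomial • groundState (nu.shift n)) (Q.monomial • groundState (nu.shift n))

end RelaxedSl2

end

open RelaxedSl2

noncomputable section

namespace RelaxedSl2

open scoped TensorProduct

attribute [local instance 100] LieRing.ofAssociativeRing

/-! ### Universal enveloping algebras -/

section Enveloping

variable {L : Type} [LieRing L] [LieAlgebra ℂ L]

/-! Both the coefficients of the string functions and the ranks of the Shapovalov matrices are ranks
of matrices whose entries are polynomials in the weight, and the same polynomials serve for all
cosets. Such a rank is constant outside a finite set (`exists_generic_rank`), and `μ + jα`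
eventually leaves every finite set; this gives the limits, their independence of `λ`, and the
generic constancy.

Polynomiality comes from the action on ground states: `e`, `h`, `f` multiply `v_μ` by polynomials in
`μ`. Moving the modes of nonnegative index to the right turns `u v_μ` into words in negative modes
applied to ground states, with polynomial coefficients. Only the empty word contributes to the
ground component (`exists_coeff_polynomial`).

This needs a well-defined projection of the relaxed Verma module onto its ground states that kills
the image of every negative mode. Instead of invoking the Poincaré-Birkhoff-Witt theorem, the proof
maps the induced module to a coinduced module `Hom(U(positive), D)`, whose action is built by
recursion, and evaluates at `1`. The kernel of this map is the largest submodule with zero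
projection. It coincides with `groundFree` (`groundFree_eq`), and membership can be tested with
words in positive modes. Hence `dim E(μ, Δ + n)` is the rank of the finite matrix of ground
components of (positive word)(negative word) on ground states (`stringFunction_eq_rank`).

A Shapovalov form is an equivariant map from the relaxed Verma module to its contragredient dual. On
ground states it amounts to norms `c_μ` with `c_μ = γ_μ c_{μ+α}`. A weight `ξ` is generating when no
`γ` vanishes at `ξ` or above it, which is what solving the recursion uniquely from `c_ξ = 1`
requires. Every entry of a Shapovalov matrix is then the norm of `v_{ν+nα}`, which is nonzero, times
a polynomial in `ν`. -/

theorem adjoin_range_iota :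
    Algebra.adjoin ℂ (Set.range (UniversalEnvelopingAlgebra.ι ℂ (L := L))) = ⊤ := by
  set S := Algebra.adjoin ℂ (Set.range (UniversalEnvelopingAlgebra.ι ℂ (L := L))) with hS
  let g : L →ₗ⁅ℂ⁆ S :=
    { toFun := fun x => ⟨UniversalEnvelopingAlgebra.ι ℂ x, Algebra.subset_adjoin ⟨x, rfl⟩⟩
      map_add' := fun x y => Subtype.ext (map_add _ x y)
      map_smul' := fun c x => Subtype.ext (map_smul _ c x)
      map_lie' := fun {x y} => Subtype.ext (LieHom.map_lie _ x y) }
  -- The lift of `g` into `S`, followed by the inclusion, agrees with the identity on generators, so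
  -- every element lies in `S`.
  have key : S.val.comp (UniversalEnvelopingAlgebra.lift ℂ g) = AlgHom.id ℂ _ := by
    apply UniversalEnvelopingAlgebra.hom_ext
    ext x
    simp only [LieHom.comp_apply, AlgHom.coe_toLieHom, AlgHom.comp_apply,
      UniversalEnvelopingAlgebra.lift_ι_apply, AlgHom.id_apply]
    rfl
  rw [eq_top_iff]
  intro u _
  have := congrArg (fun F => F u) key
  simp only [AlgHom.comp_apply, AlgHom.id_apply] at this
  rw [← this]
  exact (UniversalEnvelopingAlgebra.lift ℂ g u).2

/-- Products of elements of `L` span the enveloping algebra. The right-handed version suits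
functions on `U(N)`, on which `N` acts by right translation; the left-handed one suits modules. -/
theorem enveloping_induction_right (S : Submodule ℂ (UniversalEnvelopingAlgebra ℂ L))
    (h1 : 1 ∈ S) (hmul : ∀ u ∈ S, ∀ x : L, u * UniversalEnvelopingAlgebra.ι ℂ x ∈ S)
    (u : UniversalEnvelopingAlgebra ℂ L) : u ∈ S := by
  have hu : u ∈ Subalgebra.toSubmodule
      (Algebra.adjoin ℂ (Set.range (UniversalEnvelopingAlgebra.ι ℂ (L := L)))) := by
    rw [adjoin_range_iota]; trivial
  rw [Algebra.adjoin_eq_span] at hu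
  refine Submodule.span_le.mpr ?_ hu
  intro y hy
  induction hy using Submonoid.closure_induction_right with
  | one => exact h1
  | mul_right y _ z hz ih => obtain ⟨x, rfl⟩ := hz; exact hmul _ ih x

theorem enveloping_induction_left (S : Submodule ℂ (UniversalEnvelopingAlgebra ℂ L))
    (h1 : 1 ∈ S) (hmul : ∀ u ∈ S, ∀ x : L, UniversalEnvelopingAlgebra.ι ℂ x * u ∈ S)
    (u : UniversalEnvelopingAlgebra ℂ L) : u ∈ S := by
  have hu : u ∈ Subalgebra.toSubmodule
      (Algebra.adjoin ℂ (Set.range (UniversalEnvelopingAlgebra.ι ℂ (L := L)))) := by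
    rw [adjoin_range_iota]; trivial
  rw [Algebra.adjoin_eq_span] at hu
  refine Submodule.span_le.mpr ?_ hu
  intro y hy
  induction hy using Submonoid.closure_induction_left with
  | one => exact h1
  | mul_left z hz y _ ih => obtain ⟨x, rfl⟩ := hz; exact hmul _ ih x

end Enveloping

/-! ### Coinduced modules -/

section Coinduced

variable {L V : Type} [LieRing L] [LieAlgebra ℂ L] [AddCommGroup V] [Module ℂ V]
  (N : LieSubalgebra ℂ L)

/-- The underlying space `Hom(U(N), V)` of a coinduced module. -/
abbrev Coinduced (V : Type) [AddCommGroup V] [Module ℂ V] : Type :=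
  UniversalEnvelopingAlgebra ℂ N →ₗ[ℂ] V

/-- The action of `N` on `Hom(U(N), V)` by right translation. -/
def translation : N →ₗ⁅ℂ⁆ Module.End ℂ (Coinduced N V) where
  toFun x := LinearMap.lcomp ℂ V (LinearMap.mulRight ℂ (UniversalEnvelopingAlgebra.ι ℂ x))
  map_add' x y := by ext φ u; simp [mul_add]
  map_smul' c x := by ext φ u; simp
  map_lie' {x y} := by
    ext φ u
    simp [Ring.lie_def, mul_sub, mul_assoc, Module.End.mul_apply]

@[simp] lemma translation_apply (x : N) (φ : Coinduced N V) (u : UniversalEnvelopingAlgebra ℂ N) :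
    translation N x φ u = φ (u * UniversalEnvelopingAlgebra.ι ℂ x) := rfl

/-- The action of `N` on `L ⊗ Hom(U(N), V)`. -/
def adTranslation : N →ₗ⁅ℂ⁆ Module.End ℂ (L ⊗[ℂ] Coinduced N V) where
  toFun x := (LieAlgebra.ad ℂ L (x : L)).rTensor _ + (translation N x).lTensor L
  map_add' x y := by
    have hxy : ((x + y : N) : L) = x + y := rfl
    simp only [hxy, map_add, LinearMap.rTensor_add, LinearMap.lTensor_add]; abel
  map_smul' c x := by
    have hx : ((c • x : N) : L) = c • (x : L) := rfl
    simp only [hx, map_smul, LinearMap.rTensor_smul, LinearMap.lTensor_smul,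
      smul_add, RingHom.id_apply]
  map_lie' {x y} := by
    ext z φ : 3
    simp only [LieHom.map_lie, LieSubalgebra.coe_bracket, Ring.lie_def,
      LinearMap.rTensor_sub, LinearMap.lTensor_sub,
      LinearMap.add_apply, LinearMap.sub_apply,
      LinearMap.rTensor_tmul, LinearMap.lTensor_tmul, Module.End.mul_apply, map_add,
      TensorProduct.AlgebraTensorModule.curry_apply, TensorProduct.curry_apply,
      LinearMap.restrictScalars_self]
    abel

variable (p : L →ₗ[ℂ] N) (σ : L →ₗ[ℂ] Module.End ℂ V)

/-- The value at `1` of `z φ`. -/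
def coinducedEval : L ⊗[ℂ] Coinduced N V →ₗ[ℂ] V :=
  TensorProduct.lift <| LinearMap.mk₂ ℂ
    (fun z φ => σ z (φ 1) + φ (UniversalEnvelopingAlgebra.ι ℂ (p z)))
    (by intros; simp only [map_add, LinearMap.add_apply]; abel)
    (by intros; simp only [map_smul, LinearMap.smul_apply, smul_add])
    (by intros; simp only [map_add, LinearMap.add_apply]; abel)
    (by intros; simp only [map_smul, LinearMap.smul_apply, smul_add])

/-- The action of `L` on `Hom(U(N), V)`. -/
def coinducedAct : L →ₗ[ℂ] Module.End ℂ (Coinduced N V) :=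
  TensorProduct.curry <|
    ((UniversalEnvelopingAlgebra.lift ℂ (adTranslation N)).toLinearMap.flip).compr₂
      (coinducedEval N p σ)

lemma coinducedAct_apply (z : L) (φ : Coinduced N V) (u : UniversalEnvelopingAlgebra ℂ N) :
    coinducedAct N p σ z φ u =
      coinducedEval N p σ (UniversalEnvelopingAlgebra.lift ℂ (adTranslation N) u (z ⊗ₜ φ)) := rfl

lemma coinducedAct_one (z : L) (φ : Coinduced N V) :
    coinducedAct N p σ z φ 1 = σ z (φ 1) + φ (UniversalEnvelopingAlgebra.ι ℂ (p z)) := by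
  simp [coinducedAct_apply, coinducedEval]

/-- This is the relation `x z = [x, z] + z x`, forced by letting `N` act by translation. With
`coinducedAct_one` it determines the action by recursion on `u`. Well-definedness on `U(N)` is
automatic because the recursion comes from the tensor product representation `adTranslation`. -/
lemma coinducedAct_mul (z : L) (φ : Coinduced N V) (u : UniversalEnvelopingAlgebra ℂ N) (x : N) :
    coinducedAct N p σ z φ (u * UniversalEnvelopingAlgebra.ι ℂ x) =
      coinducedAct N p σ ⁅(x : L), z⁆ φ u + coinducedAct N p σ z (translation N x φ) u := by
  simp only [coinducedAct_apply, map_mul, UniversalEnvelopingAlgebra.lift_ι_apply,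
    Module.End.mul_apply]
  rw [← map_add, ← map_add]
  rfl

variable {N p σ}

/-- By induction on `u`: the value at `u y` is `φ(u [y, x]) + φ(u x y)`, that is `φ(u y x)`. -/
lemma coinducedAct_mem (hp : ∀ x : N, p x = x) (hσ : ∀ x : N, σ x = 0) (x : N)
    (φ : Coinduced N V) : coinducedAct N p σ x φ = translation N x φ := by
  ext u
  revert x φ
  refine enveloping_induction_right
    { carrier := {u | ∀ (x : N) (φ : Coinduced N V),
        coinducedAct N p σ x φ u = translation N x φ u}
      zero_mem' := fun x φ => by simp only [map_zero]
      add_mem' := fun {a b} ha hb x φ => by simp only [map_add, ha x φ, hb x φ]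
      smul_mem' := fun c a ha x φ => by simp only [map_smul, ha x φ] } ?_ ?_ u
  · intro x φ
    rw [coinducedAct_one, hσ, hp]
    simp
  · intro u hu y x φ
    have h1 := hu ⁅y, x⁆ φ
    rw [LieSubalgebra.coe_bracket] at h1
    rw [coinducedAct_mul, h1, hu]
    simp [Ring.lie_def, mul_assoc]

/-- The hypotheses under which `coinducedAct` is a representation: `p` is the projection to `N`
along a subalgebra, and `σ` extends by zero a representation of that subalgebra. -/
structure IsTriangular (p : L →ₗ[ℂ] N) (σ : L →ₗ[ℂ] Module.End ℂ V) : Prop where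
  proj : ∀ x : N, p x = x
  map_zero : ∀ x : N, σ x = 0
  proj_lie : ∀ y z : L, p y = 0 → p z = 0 → p ⁅y, z⁆ = 0
  map_lie : ∀ y z : L, p y = 0 → p z = 0 → σ ⁅y, z⁆ = ⁅σ y, σ z⁆

/-- By bilinearity each argument may be taken in `N` or in the kernel of `p`. Two elements of the
kernel are handled by `σ`, two elements of `N` by translation, and the mixed case by the recursion
`coinducedAct_mul` at `u = 1`. -/
lemma coinducedAct_lie_one (H : IsTriangular p σ) (y z : L) (φ : Coinduced N V) :
    coinducedAct N p σ ⁅y, z⁆ φ 1 = coinducedAct N p σ y (coinducedAct N p σ z φ) 1 -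
      coinducedAct N p σ z (coinducedAct N p σ y φ) 1 := by
  have hmul : ∀ (z : L) (φ : Coinduced N V) (x : N),
      coinducedAct N p σ z φ (UniversalEnvelopingAlgebra.ι ℂ x) =
      coinducedAct N p σ ⁅(x : L), z⁆ φ 1 + coinducedAct N p σ z (translation N x φ) 1 := by
    intro z φ x
    rw [← coinducedAct_mul, one_mul]
  obtain ⟨y', hy', hyd⟩ : ∃ y', p y' = 0 ∧ y = y' + p y :=
    ⟨y - p y, by rw [map_sub, H.proj, sub_self], by abel⟩
  obtain ⟨z', hz', hzd⟩ : ∃ z', p z' = 0 ∧ z = z' + p z :=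
    ⟨z - p z, by rw [map_sub, H.proj, sub_self], by abel⟩
  generalize p y = a at hyd
  generalize p z = b at hzd
  subst hyd hzd
  have e1 : ∀ φ : Coinduced N V, coinducedAct N p σ y' φ 1 = σ y' (φ 1) := by
    intro φ; rw [coinducedAct_one, hy']; simp
  have e2 : ∀ φ : Coinduced N V, coinducedAct N p σ z' φ 1 = σ z' (φ 1) := by
    intro φ; rw [coinducedAct_one, hz']; simp
  have e3 : ∀ φ : Coinduced N V, coinducedAct N p σ ⁅y', z'⁆ φ 1 = ⁅σ y', σ z'⁆ (φ 1) := by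
    intro φ; rw [coinducedAct_one, H.proj_lie _ _ hy' hz', H.map_lie _ _ hy' hz']; simp
  have e4 := fun (x : N) (φ : Coinduced N V) => coinducedAct_mem H.proj H.map_zero x φ
  have e5 : coinducedAct N p σ ⁅(a : L), (b : L)⁆ φ = translation N ⁅a, b⁆ φ := by
    rw [← e4, LieSubalgebra.coe_bracket]
  simp only [add_lie, lie_add, map_add, LinearMap.add_apply, e1, e2, e3, e4, e5, translation_apply,
    one_mul, hmul]
  rw [← lie_skew y' (b : L)]
  simp only [map_neg, LinearMap.neg_apply, Ring.lie_def, LinearMap.sub_apply, Module.End.mul_apply,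
    LieHom.map_lie, map_sub]
  abel

/-- By the Jacobi identity both sides obey the same recursion under `u ↦ u x`, which reduces the
claim to its value at `1`. -/
lemma coinducedAct_lie (H : IsTriangular p σ) (y z : L) :
    coinducedAct N p σ ⁅y, z⁆ = ⁅coinducedAct N p σ y, coinducedAct N p σ z⁆ := by
  ext φ u
  rw [Ring.lie_def, LinearMap.sub_apply, Module.End.mul_apply, Module.End.mul_apply,
    LinearMap.sub_apply]
  revert y z φ
  refine enveloping_induction_right
    { carrier := {u | ∀ (y z : L) (φ : Coinduced N V), coinducedAct N p σ ⁅y, z⁆ φ u =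
        coinducedAct N p σ y (coinducedAct N p σ z φ) u -
          coinducedAct N p σ z (coinducedAct N p σ y φ) u}
      zero_mem' := fun y z φ => by simp only [map_zero, sub_zero]
      add_mem' := fun {a b} ha hb y z φ => by
        simp only [map_add, ha y z φ, hb y z φ]; abel
      smul_mem' := fun c a ha y z φ => by simp only [map_smul, ha y z φ, smul_sub] } ?_ ?_ u
  · exact coinducedAct_lie_one H
  · intro u hu x y z φ
    have ht : ∀ (z : L) (φ : Coinduced N V), translation N x (coinducedAct N p σ z φ) =
        coinducedAct N p σ ⁅(x : L), z⁆ φ + coinducedAct N p σ z (translation N x φ) := by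
      intro z φ
      ext v
      rw [translation_apply, coinducedAct_mul, LinearMap.add_apply]
    rw [coinducedAct_mul, coinducedAct_mul, coinducedAct_mul, ht, ht, leibniz_lie (x : L) y z]
    have hu' : ∀ (y z : L) (φ : Coinduced N V), coinducedAct N p σ ⁅y, z⁆ φ u =
        coinducedAct N p σ y (coinducedAct N p σ z φ) u -
          coinducedAct N p σ z (coinducedAct N p σ y φ) u := hu
    simp only [map_add, LinearMap.add_apply, hu']
    abel

/-- The representation of `L` on `Hom(U(N), V)`. -/
def coinducedRep (H : IsTriangular p σ) : L →ₗ⁅ℂ⁆ Module.End ℂ (Coinduced N V) where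
  toLinearMap := coinducedAct N p σ
  map_lie' := fun {y z} => coinducedAct_lie H y z

end Coinduced

/-! ### The positive subalgebra -/

lemma loop_ext {x y : Loop} (hxy : ∀ n, loopCoeff n x = loopCoeff n y) : x = y := by
  apply (LieAlgebra.LoopAlgebra.toFinsupp ℂ ℤ sl2).injective
  ext1 n
  exact hxy n

/-- The part of a loop with positive mode indices. -/
def loopPos : Loop →ₗ[ℂ] Loop :=
  Finsupp.lsum ℂ (fun n : ℤ => if 0 < n then loopMode n else 0) ∘ₗ
    (LieAlgebra.LoopAlgebra.toFinsupp ℂ ℤ sl2).toLinearMap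

lemma loopPos_loopMode (n : ℤ) (x : sl2) :
    loopPos (loopMode n x) = if 0 < n then loopMode n x else 0 := by
  simp only [loopPos, LinearMap.comp_apply, LinearEquiv.coe_coe, toFinsupp_loopMode]
  split_ifs with hn <;> simp [hn]

lemma loopCoeff_loopPos (n : ℤ) (x : Loop) :
    loopCoeff n (loopPos x) = if 0 < n then loopCoeff n x else 0 := by
  induction x using loop_induction with
  | h0 => simp
  | hadd x y hx hy => simp only [map_add, hx, hy]; split_ifs <;> simp
  | hmode m x =>
    rw [loopPos_loopMode]
    by_cases hm : 0 < m
    · simp only [hm, if_true, loopCoeff_loopMode]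
      split_ifs with h1 h2 h2 <;> first | rfl | omega
    · simp only [hm, if_false, map_zero, loopCoeff_loopMode]
      split_ifs with h1 h2 <;> first | rfl | omega

namespace Affine

/-- The subalgebra spanned by the `x_n` with `n > 0`. -/
def positive : LieSubalgebra ℂ Affine where
  carrier := {x | (∀ n ≤ 0, loopCoeff n x.loop = 0) ∧ x.central = 0 ∧ x.deriv = 0}
  zero_mem' := ⟨fun n _ => by simp, rfl, rfl⟩
  add_mem' := by
    rintro x y ⟨hx, hx1, hx2⟩ ⟨hy, hy1, hy2⟩
    refine ⟨fun n hn => ?_, ?_, ?_⟩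
    · rw [loop_add, map_add, hx n hn, hy n hn, add_zero]
    · rw [central_add, hx1, hy1, add_zero]
    · rw [deriv_add, hx2, hy2, add_zero]
  smul_mem' := by
    rintro c x ⟨hx, hx1, hx2⟩
    refine ⟨fun n hn => ?_, ?_, ?_⟩
    · rw [loop_smul, map_smul, hx n hn, smul_zero]
    · rw [central_smul, hx1, mul_zero]
    · rw [deriv_smul, hx2, mul_zero]
  lie_mem' := by
    rintro x y ⟨hx, hx1, hx2⟩ ⟨hy, hy1, hy2⟩
    refine ⟨fun n hn => ?_, ?_, rfl⟩
    · rw [loop_lie, hx2, hy2, zero_smul, zero_smul, add_zero, sub_zero, loopCoeff_lie]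
      refine Finset.sum_eq_zero fun m _ => ?_
      by_cases hm : m ≤ 0
      · have : LieAlgebra.LoopAlgebra.toFinsupp ℂ ℤ sl2 x.loop m = 0 := hx m hm
        simp only [this, zero_lie]
      · simp only [hy (n - m) (by omega), lie_zero]
    · exact cocycle_nonneg (fun n hn => hx n hn.le) (fun n hn => hy n hn.le)

/-- The projection to the positive subalgebra. -/
def posProj : Affine →ₗ[ℂ] positive where
  toFun x := ⟨⟨loopPos x.loop, 0, 0⟩, fun n hn => by
    rw [loopCoeff_loopPos, if_neg (by omega)], rfl, rfl⟩
  map_add' x y := by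
    apply Subtype.ext
    change (⟨_, _, _⟩ : Affine) = ⟨_, _, _⟩ + ⟨_, _, _⟩
    ext1 <;> simp
  map_smul' c x := by
    apply Subtype.ext
    change (⟨_, _, _⟩ : Affine) = c • ⟨_, _, _⟩
    ext1 <;> simp

lemma posProj_coe (x : positive) : posProj x = x := by
  obtain ⟨hx, hx1, hx2⟩ := x.2
  apply Subtype.ext
  ext1
  · apply loop_ext
    intro n
    change loopCoeff n (loopPos _) = _
    rw [loopCoeff_loopPos]
    split_ifs with hn
    · rfl
    · exact (hx n (by omega)).symm
  · exact hx1.symm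
  · exact hx2.symm

lemma posProj_eq_zero {x : Affine} : posProj x = 0 ↔ ∀ n > 0, loopCoeff n x.loop = 0 := by
  constructor
  · intro hx n hn
    have h1 : loopPos x.loop = 0 := congrArg (fun y : positive => y.1.loop) hx
    have h2 := loopCoeff_loopPos n x.loop
    rw [h1, map_zero, if_pos hn] at h2
    exact h2.symm
  · intro hx
    apply Subtype.ext
    ext1
    · apply loop_ext
      intro n
      change loopCoeff n (loopPos _) = loopCoeff n 0
      rw [loopCoeff_loopPos, map_zero]
      split_ifs with hn
      · exact hx n hn
      · rfl
    · rfl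
    · rfl

lemma loopCoeff_lie_nonpos {x y : Affine} (hx : ∀ n > 0, loopCoeff n x.loop = 0)
    (hy : ∀ n > 0, loopCoeff n y.loop = 0) (n : ℤ) (hn : n > 0) :
    loopCoeff n ⁅x, y⁆.loop = 0 := by
  have h0 : loopCoeff n ⁅x.loop, y.loop⁆ = 0 := by
    rw [loopCoeff_lie]
    refine Finset.sum_eq_zero fun m _ => ?_
    by_cases hm : m > 0
    · have : LieAlgebra.LoopAlgebra.toFinsupp ℂ ℤ sl2 x.loop m = 0 := hx m hm
      simp only [this, zero_lie]
    · simp only [hy (n - m) (by omega), lie_zero]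
  rw [loop_lie, map_sub, map_add, map_smul, map_smul, h0, loopCoeff_loopDeriv,
    loopCoeff_loopDeriv, hx n hn, hy n hn]
  simp

lemma loopCoeff_zero_lie_nonpos {x y : Affine} (hx : ∀ n > 0, loopCoeff n x.loop = 0)
    (hy : ∀ n > 0, loopCoeff n y.loop = 0) :
    loopCoeff 0 ⁅x, y⁆.loop = ⁅loopCoeff 0 x.loop, loopCoeff 0 y.loop⁆ := by
  have h0 : loopCoeff 0 ⁅x.loop, y.loop⁆ = ⁅loopCoeff 0 x.loop, loopCoeff 0 y.loop⁆ := by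
    rw [loopCoeff_lie, Finsupp.sum, Finset.sum_eq_single 0]
    · rfl
    · intro m _ hm
      rcases lt_or_gt_of_ne hm with hm | hm
      · rw [hy (0 - m) (by omega), lie_zero]
      · have : LieAlgebra.LoopAlgebra.toFinsupp ℂ ℤ sl2 x.loop m = 0 := hx m hm
        rw [this, zero_lie]
    · intro hm
      rw [Finsupp.notMem_support_iff.mp hm, zero_lie]
  rw [loop_lie, map_sub, map_add, map_smul, map_smul, h0, loopCoeff_loopDeriv,
    loopCoeff_loopDeriv]
  simp

lemma cocycle_nonpos {x y : Affine} (hx : ∀ n > 0, loopCoeff n x.loop = 0)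
    (hy : ∀ n > 0, loopCoeff n y.loop = 0) : cocycle x.loop y.loop = 0 := by
  rw [cocycle, LinearMap.neg_apply, LinearMap.neg_apply,
    LieAlgebra.LoopAlgebra.residuePairing_apply_apply, neg_eq_zero]
  refine Finset.sum_eq_zero fun m _ => ?_
  rcases lt_trichotomy m 0 with hm | hm | hm
  · have : LieAlgebra.LoopAlgebra.toFinsupp ℂ ℤ sl2 x.loop (-m) = 0 := hx (-m) (by omega)
    simp [this]
  · simp [hm]
  · have : LieAlgebra.LoopAlgebra.toFinsupp ℂ ℤ sl2 y.loop m = 0 := hy m hm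
    simp [this]

lemma positive_le_nonneg {x : Affine} (hx : x ∈ positive) : x ∈ nonneg :=
  fun n hn => hx.1 n hn.le

lemma lie_mem_positive {x y : Affine} (hx : x ∈ positive) (hy : y ∈ nonneg) :
    ⁅x, y⁆ ∈ positive := by
  have hx' := positive_le_nonneg hx
  refine ⟨fun n hn => ?_, cocycle_nonneg hx' hy, rfl⟩
  rcases hn.lt_or_eq with hn | rfl
  · exact nonneg.lie_mem hx' hy n hn
  · rw [loopCoeff_zero_lie hx' hy, hx.1 0 le_rfl, zero_lie]

lemma mode_loop (n : ℤ) (x : sl2) : (mode n x).loop = loopMode n x := rfl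
lemma mode_central (n : ℤ) (x : sl2) : (mode n x).central = 0 := rfl
lemma mode_deriv (n : ℤ) (x : sl2) : (mode n x).deriv = 0 := rfl
lemma loop_L0 : L0.loop = 0 := rfl
lemma loop_K : K.loop = 0 := rfl

lemma mode_mem_nonneg {n : ℤ} (hn : 0 ≤ n) (x : sl2) : mode n x ∈ nonneg := by
  intro m hm
  rw [mode_loop, loopCoeff_loopMode, if_neg (by omega)]

lemma mode_mem_positive {n : ℤ} (hn : 0 < n) (x : sl2) : mode n x ∈ positive := by
  refine ⟨fun m hm => ?_, rfl, rfl⟩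
  rw [mode_loop, loopCoeff_loopMode, if_neg (by omega)]

lemma L0_mem_nonneg : L0 ∈ nonneg := fun n _ => by rw [loop_L0, map_zero]
lemma K_mem_nonneg : K ∈ nonneg := fun n _ => by rw [loop_K, map_zero]

lemma posProj_mode {n : ℤ} (hn : n ≤ 0) (x : sl2) : posProj (mode n x) = 0 := by
  rw [posProj_eq_zero]
  intro m hm
  rw [mode_loop, loopCoeff_loopMode, if_neg (by omega)]

lemma posProj_L0 : posProj L0 = 0 := by
  rw [posProj_eq_zero]; intro m _; rw [loop_L0, map_zero]

lemma affine_induction {p : Affine → Prop} (hadd : ∀ x y, p x → p y → p (x + y))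
    (hK : ∀ c : ℂ, p (c • K)) (hL : ∀ c : ℂ, p (c • L0)) (hmode : ∀ n x, p (mode n x))
    (x : Affine) : p x := by
  have h1 : ∀ y : Loop, p ⟨y, 0, 0⟩ := by
    intro y
    induction y using loop_induction with
    | h0 =>
      have := hmode 0 0
      rwa [map_zero] at this
    | hadd y z hy hz =>
      have := hadd _ _ hy hz
      convert this using 1
      ext1 <;> simp
    | hmode n y => exact hmode n y
  have := hadd _ _ (hadd _ _ (h1 x.loop) (hK x.central)) (hL x.deriv)
  convert this using 1
  ext1 <;> simp [K, L0]

end Affine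

/-! ### Lifting maps from induced modules -/

section InducedLift

variable {L V M : Type} [LieRing L] [LieAlgebra ℂ L] [AddCommGroup V] [Module ℂ V]
  [AddCommGroup M] [Module ℂ M]
  {P : LieSubalgebra ℂ L} {ρ : P →ₗ⁅ℂ⁆ Module.End ℂ V}

/-- Frobenius reciprocity. It is used twice: with a coinduced module as target, to get the
projection to the ground states, and with the dual module as target, to get the Shapovalov form. -/
lemma exists_induced_lift (τ : L →ₗ⁅ℂ⁆ Module.End ℂ M) (β : V →ₗ[ℂ] M)
    (hβ : ∀ (y : P) (v : V), τ y (β v) = β (ρ y v)) :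
    ∃ F : Induced P ρ →ₗ[ℂ] M,
      (∀ v, F ((inducedRelations P ρ).mkQ (1 ⊗ₜ v)) = β v) ∧
      ∀ (u : UniversalEnvelopingAlgebra ℂ L) (r : Induced P ρ),
        F (u • r) = UniversalEnvelopingAlgebra.lift ℂ τ u (F r) := by
  let T := UniversalEnvelopingAlgebra.lift ℂ τ
  let F₀ : UniversalEnvelopingAlgebra ℂ L ⊗[ℂ] V →ₗ[ℂ] M :=
    TensorProduct.lift ((LinearMap.lcomp ℂ M β) ∘ₗ T.toLinearMap)
  have hF₀ : ∀ u v, F₀ (u ⊗ₜ v) = T u (β v) := fun u v => rfl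
  have hsmul : ∀ u z, F₀ (u • z) = T u (F₀ z) := by
    intro u z
    induction z using TensorProduct.induction_on with
    | zero => simp
    | tmul a v => rw [TensorProduct.smul_tmul', hF₀, hF₀, smul_eq_mul, map_mul]; rfl
    | add a b ha hb => rw [smul_add, map_add, ha, hb, map_add, map_add]
  have hker : (inducedRelations P ρ).restrictScalars ℂ ≤ LinearMap.ker F₀ := by
    intro z hz
    rw [Submodule.restrictScalars_mem] at hz
    rw [LinearMap.mem_ker]
    induction hz using Submodule.span_induction with
    | mem z hz =>
      obtain ⟨u, y, v, rfl⟩ := hz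
      rw [map_sub, hF₀, hF₀, map_mul, UniversalEnvelopingAlgebra.lift_ι_apply,
        Module.End.mul_apply, hβ, sub_self]
    | zero => exact map_zero _
    | add a b _ _ ha hb => rw [map_add, ha, hb, add_zero]
    | smul u z _ hz => rw [hsmul, hz, map_zero]
  -- The quotient is by a `U(L)`-submodule, whereas `F₀` is only a `ℂ`-linear map; hence the passage
  -- to restricted scalars.
  refine ⟨Submodule.liftQ _ F₀ hker ∘ₗ
    (Submodule.Quotient.restrictScalarsEquiv ℂ (inducedRelations P ρ)).symm.toLinearMap, ?_, ?_⟩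
  · intro v
    change F₀ (1 ⊗ₜ v) = _
    rw [hF₀, map_one, Module.End.one_apply]
  · intro u r
    obtain ⟨z, rfl⟩ := Submodule.mkQ_surjective _ r
    exact hsmul u z

end InducedLift

/-! ### The projection of an induced module to its ground states -/

section Projection

variable {V : Type} [AddCommGroup V] [Module ℂ V] {σ : Affine →ₗ[ℂ] Module.End ℂ V}

/-- The augmentation of `U(positive)`. -/
def augmentation : UniversalEnvelopingAlgebra ℂ Affine.positive →ₐ[ℂ] ℂ :=
  UniversalEnvelopingAlgebra.lift ℂ 0

lemma augmentation_iota (x : Affine.positive) :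
    augmentation (UniversalEnvelopingAlgebra.ι ℂ x) = 0 := by
  rw [augmentation, UniversalEnvelopingAlgebra.lift_ι_apply]; rfl

/-- The functions `u ↦ ε(u) v`. -/
def augmentationMap : V →ₗ[ℂ] Coinduced Affine.positive V :=
  LinearMap.mk₂ ℂ (fun v u => augmentation u • v) (by simp) (fun c v u => smul_comm _ _ _)
    (by simp [add_smul]) (by simp [mul_smul])

lemma augmentationMap_apply (v : V) (u : UniversalEnvelopingAlgebra ℂ Affine.positive) :
    augmentationMap v u = augmentation u • v := rfl

/-- The positive modes form an ideal of the nonnegative subalgebra. So in the recursion for `u x`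
the bracket `[x, y]` is again positive, where `σ` vanishes, and both sides are zero off the
constants. This is the equivariance required by `exists_induced_lift`. -/
lemma coinducedRep_augmentationMap (H : IsTriangular Affine.posProj σ) (v : V) (y : Affine)
    (hy : y ∈ Affine.nonneg) :
    coinducedRep H y (augmentationMap v) = augmentationMap (σ y v) := by
  change coinducedAct _ _ _ y _ = _
  ext1 u
  revert y
  refine enveloping_induction_right
    { carrier := {u | ∀ y ∈ Affine.nonneg, coinducedAct Affine.positive Affine.posProj σ y
          (augmentationMap v) u = augmentationMap (σ y v) u}
      zero_mem' := fun y _ => by simp only [map_zero]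
      add_mem' := fun {a b} ha hb y hy => by simp only [map_add, ha y hy, hb y hy]
      smul_mem' := fun c a ha y hy => by simp only [map_smul, ha y hy] } ?_ ?_ u
  · intro y hy
    rw [coinducedAct_one, augmentationMap_apply, augmentationMap_apply, augmentationMap_apply,
      map_one, augmentation_iota, zero_smul, one_smul, add_zero, one_smul]
  · intro u hu x y hy
    have h0 : translation Affine.positive x (augmentationMap v) = 0 := by
      ext1 w
      rw [translation_apply, augmentationMap_apply, map_mul, augmentation_iota, mul_zero,
        zero_smul]
      rfl
    have h1 := Affine.lie_mem_positive x.2 hy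
    rw [coinducedAct_mul, h0, hu _ (Affine.positive_le_nonneg h1), H.map_zero ⟨_, h1⟩,
      augmentationMap_apply, augmentationMap_apply, map_mul, augmentation_iota]
    simp

/-- At `w = 1` this recovers every value of `φ` from values at `1` of translates of `φ`: positive
modes followed by evaluation at `1` detect whether `φ` vanishes. -/
lemma lift_coinducedRep_apply (H : IsTriangular Affine.posProj σ)
    (u : UniversalEnvelopingAlgebra ℂ Affine.positive) (φ : Coinduced Affine.positive V)
    (w : UniversalEnvelopingAlgebra ℂ Affine.positive) :
    UniversalEnvelopingAlgebra.lift ℂ (coinducedRep H)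
      (UniversalEnvelopingAlgebra.lift ℂ (iota.comp Affine.positive.incl) u) φ w = φ (w * u) := by
  revert φ w
  refine enveloping_induction_right
    { carrier := {u | ∀ (φ : Coinduced Affine.positive V) w,
        UniversalEnvelopingAlgebra.lift ℂ (coinducedRep H)
          (UniversalEnvelopingAlgebra.lift ℂ (iota.comp Affine.positive.incl) u) φ w =
          φ (w * u)}
      zero_mem' := fun φ w => by simp only [map_zero, mul_zero, LinearMap.zero_apply]
      add_mem' := fun {a b} ha hb φ w => by
        simp only [map_add, mul_add, LinearMap.add_apply, ha φ w, hb φ w]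
      smul_mem' := fun c a ha φ w => by
        simp only [map_smul, LinearMap.smul_apply, ha φ w, mul_smul_comm] } ?_ ?_ u
  · intro φ w; simp only [map_one, mul_one, Module.End.one_apply]
  · intro u hu x φ w
    have h1 : coinducedRep H (x : Affine) φ = translation _ x φ :=
      coinducedAct_mem H.proj H.map_zero x φ
    have h2 : Affine.positive.incl x = (x : Affine) := rfl
    rw [map_mul, map_mul, Module.End.mul_apply, hu, UniversalEnvelopingAlgebra.lift_ι_apply,
      LieHom.comp_apply, UniversalEnvelopingAlgebra.lift_ι_apply, h2, h1,
      translation_apply, mul_assoc]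

/-- The induced module projects to its ground states, equivariantly for the modes of nonpositive
index, and the largest submodule in the kernel is detected by the modes of positive index. -/
lemma exists_projection (ρ : Affine.nonneg →ₗ⁅ℂ⁆ Module.End ℂ V)
    (H : IsTriangular Affine.posProj σ) (hρ : ∀ y, ρ y = σ y) :
    ∃ π : Induced Affine.nonneg ρ →ₗ[ℂ] V,
      (∀ v, π ((inducedRelations Affine.nonneg ρ).mkQ (1 ⊗ₜ v)) = v) ∧
      (∀ z, Affine.posProj z = 0 → ∀ r, π (iota z • r) = σ z (π r)) ∧
      ∀ r, (∀ u, π (UniversalEnvelopingAlgebra.lift ℂ (iota.comp Affine.positive.incl) u • r) = 0) →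
        ∀ u : U, π (u • r) = 0 := by
  obtain ⟨F, hF1, hF2⟩ := exists_induced_lift (ρ := ρ) (coinducedRep H) augmentationMap
    fun y v => by rw [coinducedRep_augmentationMap H v y.1 y.2, hρ]
  have h1 : ∀ (z : Affine) φ, coinducedRep H z φ 1 =
      σ z (φ 1) + φ (UniversalEnvelopingAlgebra.ι ℂ (Affine.posProj z)) := fun z φ =>
    coinducedAct_one _ _ _ z φ
  -- The projection is the value at `1` of the associated function on `U(positive)`.
  refine ⟨LinearMap.applyₗ (1 : UniversalEnvelopingAlgebra ℂ Affine.positive) ∘ₗ F, ?_, ?_, ?_⟩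
  · intro v
    change F _ 1 = v
    rw [hF1, augmentationMap_apply, map_one, one_smul]
  · intro z hz r
    change F _ 1 = σ z (F r 1)
    rw [hF2, UniversalEnvelopingAlgebra.lift_ι_apply, h1, hz, map_zero, map_zero, add_zero]
  · intro r hr u
    have h2 : F r = 0 := by
      ext1 u
      have h3 : F _ 1 = 0 := hr u
      rw [hF2, lift_coinducedRep_apply, one_mul] at h3
      exact h3
    change F _ 1 = 0
    rw [hF2, h2, map_zero]; rfl

end Projection

/-! ### The projection of the relaxed Verma module onto its ground states -/

lemma lie_add_smul_one {A : Type} [Ring A] [Algebra ℂ A] (a b : A) (c d : ℂ) :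
    ⁅a + c • (1 : A), b + d • (1 : A)⁆ = ⁅a, b⁆ := by
  simp only [Ring.lie_def, mul_add, add_mul, mul_smul_comm, smul_mul_assoc, mul_one, one_mul]
  module

section Top

variable (k Δ q : ℂ) (lam : WeightCoset)

/-- The extension of `groundRep` by zero on the modes of nonzero index. -/
def topRep : Affine →ₗ[ℂ] Module.End ℂ (Dense lam) where
  toFun x := denseRep q lam (loopCoeff 0 x.loop) + (k * x.central + Δ * x.deriv) • 1
  map_add' x y := by
    simp only [Affine.loop_add, Affine.central_add, Affine.deriv_add, map_add]
    module
  map_smul' c x := by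
    simp only [Affine.loop_smul, Affine.central_smul, Affine.deriv_smul, map_smul,
      RingHom.id_apply]
    module

lemma topRep_apply (x : Affine) : topRep k Δ q lam x =
    denseRep q lam (loopCoeff 0 x.loop) + (k * x.central + Δ * x.deriv) • 1 := rfl

lemma groundRep_apply (y : Affine.nonneg) : groundRep k Δ q lam y = topRep k Δ q lam y := rfl

lemma topRep_positive {x : Affine} (hx : x ∈ Affine.positive) : topRep k Δ q lam x = 0 := by
  rw [topRep_apply, hx.1 0 le_rfl, hx.2.1, hx.2.2]; simp

/-- `topRep` need not be a representation of the whole affine algebra. On modes of nonpositive index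
it is one: there the zero mode of a bracket is the bracket of the zero modes, and the cocycle
vanishes. -/
lemma topRep_lie {y z : Affine} (hy : Affine.posProj y = 0) (hz : Affine.posProj z = 0) :
    topRep k Δ q lam ⁅y, z⁆ = ⁅topRep k Δ q lam y, topRep k Δ q lam z⁆ := by
  rw [Affine.posProj_eq_zero] at *
  rw [topRep_apply, Affine.loopCoeff_zero_lie_nonpos hy hz, Affine.central_lie,
    Affine.cocycle_nonpos hy hz, Affine.deriv_lie, LieHom.map_lie, mul_zero, mul_zero, add_zero,
    zero_smul, add_zero]
  exact (lie_add_smul_one _ _ _ _).symm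

lemma isTriangular_topRep : IsTriangular Affine.posProj (topRep k Δ q lam) where
  proj := Affine.posProj_coe
  map_zero x := topRep_positive k Δ q lam x.2
  proj_lie y z hy hz := by
    rw [Affine.posProj_eq_zero] at *
    exact Affine.loopCoeff_lie_nonpos hy hz
  map_lie y z hy hz := topRep_lie k Δ q lam hy hz

/-- The projection of the relaxed Verma module to its ground states. -/
def toGround : RelaxedVerma k Δ q lam →ₗ[ℂ] Dense lam :=
  (exists_projection (groundRep k Δ q lam) (isTriangular_topRep k Δ q lam)
    (groundRep_apply k Δ q lam)).choose

variable {k Δ q lam}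

lemma toGround_groundMap (v : Dense lam) : toGround k Δ q lam (groundMap k Δ q lam v) = v :=
  (exists_projection (groundRep k Δ q lam) (isTriangular_topRep k Δ q lam)
    (groundRep_apply k Δ q lam)).choose_spec.1 v

lemma toGround_smul {z : Affine} (hz : Affine.posProj z = 0) (r : RelaxedVerma k Δ q lam) :
    toGround k Δ q lam (iota z • r) = topRep k Δ q lam z (toGround k Δ q lam r) :=
  (exists_projection (groundRep k Δ q lam) (isTriangular_topRep k Δ q lam)
    (groundRep_apply k Δ q lam)).choose_spec.2.1 z hz r

lemma toGround_smul_eq_zero (r : RelaxedVerma k Δ q lam)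
    (hr : ∀ u, toGround k Δ q lam
      (UniversalEnvelopingAlgebra.lift ℂ (iota.comp Affine.positive.incl) u • r) = 0) (u : U) :
    toGround k Δ q lam (u • r) = 0 :=
  (exists_projection (groundRep k Δ q lam) (isTriangular_topRep k Δ q lam)
    (groundRep_apply k Δ q lam)).choose_spec.2.2 r hr u

lemma groundMap_smul {y : Affine} (hy : y ∈ Affine.nonneg) (v : Dense lam) :
    iota y • groundMap k Δ q lam v = groundMap k Δ q lam (topRep k Δ q lam y v) := by
  refine (Submodule.Quotient.eq _).mpr (Submodule.subset_span ⟨1, ⟨y, hy⟩, v, ?_⟩)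
  rw [one_mul]
  change (iota y * 1) ⊗ₜ[ℂ] v - _ = _
  rw [mul_one]
  rfl

end Top

/-! ### Words in the modes -/

lemma e_coe : e.1 = !![0, 1; 0, 0] := by
  change Matrix.single 0 1 1 = _
  ext i j; fin_cases i <;> fin_cases j <;> simp [Matrix.single]

lemma f_coe : f.1 = !![0, 0; 1, 0] := by
  change Matrix.single 1 0 1 = _
  ext i j; fin_cases i <;> fin_cases j <;> simp [Matrix.single]

lemma h_coe : h.1 = !![1, 0; 0, -1] := by
  rw [h, LieAlgebra.SpecialLinear.val_singleSubSingle]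
  ext i j; fin_cases i <;> fin_cases j <;> simp [Matrix.single]

lemma sl2_eq (x : sl2) : x = x.1 0 0 • h + x.1 0 1 • e + x.1 1 0 • f := by
  have hz : Matrix.trace x.1 = 0 := x.2
  rw [Matrix.trace_fin_two] at hz
  apply Subtype.ext
  change x.1 = x.1 0 0 • h.1 + x.1 0 1 • e.1 + x.1 1 0 • f.1
  ext i j
  fin_cases i <;> fin_cases j <;> simp [e_coe, f_coe, h_coe]
  linear_combination hz

/-- The basis `e, h, f`. -/
def gen : Fin 3 → sl2 := ![e, h, f]

/-- The weights of `e, h, f` in units of `α`. -/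
def genWeight : Fin 3 → ℤ := ![1, 0, -1]

lemma lie_h_gen (i : Fin 3) : ⁅h, gen i⁆ = (2 * genWeight i : ℂ) • gen i := by
  apply Subtype.ext
  rw [LieAlgebra.SpecialLinear.sl_bracket]
  change _ = (2 * genWeight i : ℂ) • (gen i).1
  ext a b
  fin_cases i <;> fin_cases a <;> fin_cases b <;>
    simp [gen, genWeight, e_coe, f_coe, h_coe] <;> norm_num

/-- The product of the letters of a word in the universal enveloping algebra. -/
def wordProd {ι : Type} (l : ι → Affine) (w : List ι) : U := (w.map fun a => iota (l a)).prod

section Words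

variable {ι : Type} (l : ι → Affine)

@[simp] lemma wordProd_nil : wordProd l [] = 1 := rfl

@[simp] lemma wordProd_cons (a : ι) (w : List ι) :
    wordProd l (a :: w) = iota (l a) * wordProd l w := rfl

lemma wordProd_append (v w : List ι) :
    wordProd l (v ++ w) = wordProd l v * wordProd l w := by
  simp [wordProd]

lemma iota_mul (x y : Affine) : iota x * iota y = iota y * iota x + iota ⁅x, y⁆ := by
  rw [LieHom.map_lie, Ring.lie_def]; abel

variable {M : Type} [AddCommGroup M] [Module ℂ M] [Module U M] [IsScalarTower ℂ U M]

/-- Each letter shifts the eigenvalue by its own adjoint eigenvalue. This is applied to `h_0` and to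
`L₀`. -/
lemma wordProd_eigen {y : Affine} {c : ι → ℂ} (hy : ∀ a, ⁅y, l a⁆ = c a • l a) {r : M} {t : ℂ}
    (hr : iota y • r = t • r) (w : List ι) :
    iota y • wordProd l w • r = (t + (w.map c).sum) • wordProd l w • r := by
  induction w with
  | nil => simpa using hr
  | cons a w ih =>
    rw [wordProd_cons, mul_smul, ← mul_smul (iota y), iota_mul, add_smul, mul_smul, ih, hy,
      map_smul, smul_assoc, smul_algebra_smul_comm, List.map_cons, List.sum_cons, ← add_smul]
    congr 1
    ring

/-- If `X` is stable under `P` and the letters together with `P` span the affine algebra, then the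
words applied to `X` span a submodule. -/
lemma word_span_stable (P : Set Affine)
    (hspan : ∀ z : Affine, z ∈ Submodule.span ℂ (Set.range l ∪ P))
    (X : Submodule ℂ M) (hX : ∀ y ∈ P, ∀ x ∈ X, iota y • x ∈ X)
    (u : U) (r : M) (hr : r ∈ Submodule.span ℂ {m | ∃ w, ∃ x ∈ X, m = wordProd l w • x}) :
    u • r ∈ Submodule.span ℂ {m | ∃ w, ∃ x ∈ X, m = wordProd l w • x} := by
  set S := Submodule.span ℂ {m | ∃ w, ∃ x ∈ X, m = wordProd l w • x} with hS
  have hlin : ∀ (u : U), (∀ w, ∀ x ∈ X, u • wordProd l w • x ∈ S) → ∀ r ∈ S, u • r ∈ S := by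
    intro u hu r hr
    induction hr using Submodule.span_induction with
    | mem m hm => obtain ⟨w, x, hx, rfl⟩ := hm; exact hu w x hx
    | zero => rw [smul_zero]; exact zero_mem _
    | add a b _ _ ha hb => rw [smul_add]; exact add_mem ha hb
    | smul c a _ ha => rw [smul_algebra_smul_comm]; exact Submodule.smul_mem _ _ ha
  have hletter : ∀ a, ∀ r ∈ S, iota (l a) • r ∈ S := fun a => hlin _ fun w x hx =>
    Submodule.subset_span ⟨a :: w, x, hx, by rw [wordProd_cons, mul_smul]⟩
  -- `z` is moved to the right by `z a = a z + [z, a]`. The induction on the word runs over all `z`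
  -- at once and so also covers `[z, a]`; the letters never need to be ordered.
  have hall : ∀ z : Affine, ∀ w, ∀ x ∈ X, iota z • wordProd l w • x ∈ S := by
    intro z w
    induction w generalizing z with
    | nil =>
      intro x hx
      refine Submodule.span_induction (p := fun z _ => iota z • wordProd l [] • x ∈ S)
        ?_ ?_ ?_ ?_ (hspan z)
      · rintro z (⟨a, rfl⟩ | hz)
        · exact Submodule.subset_span ⟨[a], x, hx, by simp⟩
        · exact Submodule.subset_span ⟨[], _, hX z hz x hx, by simp⟩
      · simp
      · intro a b _ _ ha hb
        rw [map_add, add_smul]; exact add_mem ha hb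
      · intro c a _ ha
        rw [map_smul, smul_assoc]; exact Submodule.smul_mem _ _ ha
    | cons a w ih =>
      intro x hx
      rw [wordProd_cons, mul_smul, ← mul_smul, iota_mul, add_smul, mul_smul]
      exact add_mem (hletter a _ (ih z x hx)) (ih _ x hx)
  have key := enveloping_induction_left (L := Affine)
    { carrier := {u : U | ∀ r ∈ S, u • r ∈ S}
      zero_mem' := fun r _ => by rw [zero_smul]; exact zero_mem _
      add_mem' := fun {a b} ha hb r hr => by rw [add_smul]; exact add_mem (ha r hr) (hb r hr)
      smul_mem' := fun c a ha r hr => by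
        rw [smul_assoc]; exact Submodule.smul_mem _ _ (ha r hr) }
    (fun r hr => by rwa [one_smul])
    (fun u hu z r hr => by rw [mul_smul]; exact hlin _ (hall z) _ (hu r hr)) u
  exact key r hr

end Words

/-! ### Modes acting on ground states -/

/-- A letter `(i, n)` stands for a mode of the generator `gen i` of index `± (n + 1)`. -/
abbrev Letter : Type := Fin 3 × ℕ

/-- The modes of negative index. -/
def negLetter (a : Letter) : Affine := Affine.mode (-(a.2 + 1 : ℤ)) (gen a.1)

/-- The modes of positive index. -/
def posLetter (a : Letter) : Affine := Affine.mode (a.2 + 1 : ℤ) (gen a.1)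

/-- The total mode index of a word. -/
def grade (w : List Letter) : ℕ := (w.map fun a => a.2 + 1).sum

/-- The `sl₂`-weight of a word, in units of `α`. -/
def wordWeight (w : List Letter) : ℤ := (w.map fun a => genWeight a.1).sum

lemma posProj_negLetter (a : Letter) : Affine.posProj (negLetter a) = 0 :=
  Affine.posProj_mode (by omega) _

lemma mode_mem_of_gen {S : Submodule ℂ Affine} {n : ℤ}
    (hS : ∀ i, Affine.mode n (gen i) ∈ S) (x : sl2) : Affine.mode n x ∈ S := by
  rw [sl2_eq x]
  simp only [map_add, map_smul]
  exact add_mem (add_mem (S.smul_mem _ (hS 1)) (S.smul_mem _ (hS 0))) (S.smul_mem _ (hS 2))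

lemma mem_span_negLetter (z : Affine) :
    z ∈ Submodule.span ℂ (Set.range negLetter ∪ (Affine.nonneg : Set Affine)) := by
  induction z using Affine.affine_induction with
  | hadd x y hx hy => exact add_mem hx hy
  | hK c => exact Submodule.smul_mem _ _ (Submodule.subset_span (Or.inr Affine.K_mem_nonneg))
  | hL c => exact Submodule.smul_mem _ _ (Submodule.subset_span (Or.inr Affine.L0_mem_nonneg))
  | hmode n x =>
    rcases lt_or_ge n 0 with hn | hn
    · refine mode_mem_of_gen (fun i => Submodule.subset_span (Or.inl ⟨(i, (-n - 1).toNat), ?_⟩)) x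
      simp only [negLetter]
      congr 1
      congr 1
      omega
    · exact Submodule.subset_span (Or.inr (Affine.mode_mem_nonneg hn x))

lemma L0_lie_negLetter (a : Letter) :
    ⁅Affine.L0, negLetter a⁆ = ((a.2 + 1 : ℕ) : ℂ) • negLetter a := by
  rw [negLetter, Affine.L0_lie_mode]
  congr 1
  push_cast; ring

lemma L0_lie_posLetter (a : Letter) :
    ⁅Affine.L0, posLetter a⁆ = (-((a.2 + 1 : ℕ) : ℂ)) • posLetter a := by
  rw [posLetter, Affine.L0_lie_mode]
  push_cast; rfl

lemma h_lie_mode_gen (n : ℤ) (i : Fin 3) : ⁅Affine.mode 0 h, Affine.mode n (gen i)⁆ =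
    (2 * genWeight i : ℂ) • Affine.mode n (gen i) := by
  rw [Affine.mode_lie_mode, lie_h_gen, map_smul]
  simp

section Weights

variable {M : Type} [AddCommGroup M] [Module ℂ M] [Module U M] [IsScalarTower ℂ U M]

lemma sum_map_two_mul (w : List Letter) :
    (w.map fun a => (2 * genWeight a.1 : ℂ)).sum = 2 * (wordWeight w : ℂ) := by
  induction w with
  | nil => simp [wordWeight]
  | cons a w ih =>
    rw [List.map_cons, List.sum_cons, ih, wordWeight, wordWeight, List.map_cons, List.sum_cons]
    push_cast; ring

lemma sum_map_grade (w : List Letter) :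
    (w.map fun a => ((a.2 + 1 : ℕ) : ℂ)).sum = (grade w : ℂ) := by
  induction w with
  | nil => simp [grade]
  | cons a w ih =>
    rw [List.map_cons, List.sum_cons, ih, grade, grade, List.map_cons, List.sum_cons]
    push_cast; ring

lemma sum_map_neg_grade (w : List Letter) :
    (w.map fun a => -((a.2 + 1 : ℕ) : ℂ)).sum = -(grade w : ℂ) := by
  induction w with
  | nil => simp [grade]
  | cons a w ih =>
    rw [List.map_cons, List.sum_cons, ih, grade, grade, List.map_cons, List.sum_cons]
    push_cast; ring

lemma h_smul_negWord {r : M} {t : ℂ} (hr : iota (Affine.mode 0 h) • r = t • r)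
    (w : List Letter) : iota (Affine.mode 0 h) • wordProd negLetter w • r =
      (t + 2 * wordWeight w) • wordProd negLetter w • r := by
  rw [wordProd_eigen negLetter (fun a => h_lie_mode_gen _ a.1) hr, sum_map_two_mul]

lemma h_smul_posWord {r : M} {t : ℂ} (hr : iota (Affine.mode 0 h) • r = t • r)
    (w : List Letter) : iota (Affine.mode 0 h) • wordProd posLetter w • r =
      (t + 2 * wordWeight w) • wordProd posLetter w • r := by
  rw [wordProd_eigen posLetter (fun a => h_lie_mode_gen _ a.1) hr, sum_map_two_mul]

lemma L0_smul_negWord {r : M} {t : ℂ} (hr : iota Affine.L0 • r = t • r)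
    (w : List Letter) : iota Affine.L0 • wordProd negLetter w • r =
      (t + grade w) • wordProd negLetter w • r := by
  rw [wordProd_eigen negLetter L0_lie_negLetter hr, sum_map_grade]

lemma L0_smul_posWord {r : M} {t : ℂ} (hr : iota Affine.L0 • r = t • r)
    (w : List Letter) : iota Affine.L0 • wordProd posLetter w • r =
      (t - grade w) • wordProd posLetter w • r := by
  rw [wordProd_eigen posLetter L0_lie_posLetter hr, sum_map_neg_grade, sub_eq_add_neg]

end Weights

section Ground

variable {k Δ q : ℂ} {lam : WeightCoset}

/-- The coefficient of `e v_μ`. -/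
def gamma (q mu : ℂ) : ℂ := (q - casimirValue mu) / 2

lemma topRep_single (y : Affine) (mu : CosetWeight lam) :
    topRep k Δ q lam y (Finsupp.single mu 1) =
      ((loopCoeff 0 y.loop).1 0 0 * mu.val + (k * y.central + Δ * y.deriv)) •
          Finsupp.single mu 1 +
        ((loopCoeff 0 y.loop).1 0 1 * gamma q mu.val) • Finsupp.single (mu.shift 1) 1 +
        (loopCoeff 0 y.loop).1 1 0 • Finsupp.single (mu.shift (-1)) 1 := by
  rw [topRep_apply]
  generalize loopCoeff 0 y.loop = x
  change (x.1 0 0 • denseH lam + x.1 0 1 • denseE q lam + x.1 1 0 • denseF lam +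
    (k * y.central + Δ * y.deriv) • 1) _ = _
  simp only [LinearMap.add_apply, LinearMap.smul_apply, denseH, denseE, denseF,
    Finsupp.linearCombination_single, Finsupp.smul_single, smul_eq_mul, one_mul, mul_one,
    Module.End.one_apply, gamma, Finsupp.single_add]
  abel

lemma smul_groundState {y : Affine} (hy : y ∈ Affine.nonneg) (mu : CosetWeight lam) :
    iota y • (groundState mu : RelaxedVerma k Δ q lam) =
      ((loopCoeff 0 y.loop).1 0 0 * mu.val + (k * y.central + Δ * y.deriv)) • groundState mu +
        ((loopCoeff 0 y.loop).1 0 1 * gamma q mu.val) • groundState (mu.shift 1) +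
        (loopCoeff 0 y.loop).1 1 0 • groundState (mu.shift (-1)) := by
  rw [groundState, groundMap_smul hy, topRep_single, map_add, map_add, map_smul, map_smul,
    map_smul]
  rfl

lemma loopCoeff_zero_mode_zero (x : sl2) : loopCoeff 0 (Affine.mode 0 x).loop = x := by
  rw [Affine.mode_loop, loopCoeff_loopMode, if_pos rfl]

lemma h_smul_groundState (mu : CosetWeight lam) :
    iota (Affine.mode 0 h) • (groundState mu : RelaxedVerma k Δ q lam) =
      mu.val • groundState mu := by
  rw [smul_groundState (Affine.mode_mem_nonneg le_rfl h), loopCoeff_zero_mode_zero, h_coe,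
    Affine.mode_central, Affine.mode_deriv]
  simp

lemma e_smul_groundState (mu : CosetWeight lam) :
    iota (Affine.mode 0 e) • (groundState mu : RelaxedVerma k Δ q lam) =
      gamma q mu.val • groundState (mu.shift 1) := by
  rw [smul_groundState (Affine.mode_mem_nonneg le_rfl e), loopCoeff_zero_mode_zero, e_coe,
    Affine.mode_central, Affine.mode_deriv]
  simp

lemma f_smul_groundState (mu : CosetWeight lam) :
    iota (Affine.mode 0 f) • (groundState mu : RelaxedVerma k Δ q lam) =
      groundState (mu.shift (-1)) := by
  rw [smul_groundState (Affine.mode_mem_nonneg le_rfl f), loopCoeff_zero_mode_zero, f_coe,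
    Affine.mode_central, Affine.mode_deriv]
  simp

lemma L0_smul_groundState (mu : CosetWeight lam) :
    iota Affine.L0 • (groundState mu : RelaxedVerma k Δ q lam) = Δ • groundState mu := by
  rw [smul_groundState Affine.L0_mem_nonneg, Affine.loop_L0, map_zero]
  change ((0 : ℂ) * _ + (k * 0 + Δ * 1)) • _ + ((0 : ℂ) * _) • _ + (0 : ℂ) • _ = _
  simp

lemma toGround_groundState (mu : CosetWeight lam) :
    toGround k Δ q lam (groundState mu) = Finsupp.single mu 1 := toGround_groundMap _

/-- The projection commutes with nonpositive modes, and those of negative index act by zero under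
`topRep`. Hence only the empty word has a ground component. -/
lemma toGround_negLetter (a : Letter) (r : RelaxedVerma k Δ q lam) :
    toGround k Δ q lam (iota (negLetter a) • r) = 0 := by
  rw [toGround_smul (posProj_negLetter a), topRep_apply, negLetter, Affine.mode_loop,
    loopCoeff_loopMode, if_neg (by omega), Affine.mode_central, Affine.mode_deriv]
  simp

lemma groundMap_mem_span (v : Dense lam) : groundMap k Δ q lam v ∈
    Submodule.span ℂ (Set.range fun mu : CosetWeight lam => groundState mu) := by
  induction v using Finsupp.induction_linear with
  | zero => rw [map_zero]; exact zero_mem _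
  | add a b ha hb => rw [map_add]; exact add_mem ha hb
  | single mu c =>
    rw [← mul_one c, ← smul_eq_mul, ← Finsupp.smul_single, map_smul]
    exact Submodule.smul_mem _ _ (Submodule.subset_span ⟨mu, rfl⟩)

/-- A `ℂ`-subspace stable under `U` and containing the ground states is everything. -/
lemma mem_of_groundState_mem (S : Submodule ℂ (RelaxedVerma k Δ q lam))
    (hU : ∀ (u : U), ∀ r ∈ S, u • r ∈ S) (hS : ∀ mu, groundState mu ∈ S)
    (r : RelaxedVerma k Δ q lam) : r ∈ S := by
  have h1 : ∀ v, groundMap k Δ q lam v ∈ S := fun v =>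
    Submodule.span_le.mpr (by rintro _ ⟨mu, rfl⟩; exact hS mu) (groundMap_mem_span v)
  obtain ⟨z, rfl⟩ := Submodule.mkQ_surjective _ r
  induction z using TensorProduct.induction_on with
  | zero => rw [map_zero]; exact zero_mem _
  | add a b ha hb => rw [map_add]; exact add_mem ha hb
  | tmul u v =>
    have h2 : (inducedRelations Affine.nonneg (groundRep k Δ q lam)).mkQ (u ⊗ₜ v) =
        u • groundMap k Δ q lam v := by
      change _ = (inducedRelations Affine.nonneg (groundRep k Δ q lam)).mkQ ((u * 1) ⊗ₜ v)
      rw [mul_one]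
    rw [h2]
    exact hU u _ (h1 v)

/-- The relaxed Verma module is spanned by the words in the modes of negative index applied to the
ground states. -/
lemma mem_span_negWords (r : RelaxedVerma k Δ q lam) :
    r ∈ Submodule.span ℂ {m : RelaxedVerma k Δ q lam |
      ∃ w mu, m = wordProd negLetter w • groundState mu} := by
  have h1 : r ∈ Submodule.span ℂ {m : RelaxedVerma k Δ q lam |
      ∃ w, ∃ x ∈ LinearMap.range (groundMap k Δ q lam), m = wordProd negLetter w • x} := by
    refine mem_of_groundState_mem (Submodule.span ℂ {m : RelaxedVerma k Δ q lam |
      ∃ w, ∃ x ∈ LinearMap.range (groundMap k Δ q lam), m = wordProd negLetter w • x})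
      (fun u r hr => ?_) (fun mu => ?_) r
    · refine word_span_stable negLetter (Affine.nonneg : Set Affine) mem_span_negLetter
        (LinearMap.range (groundMap k Δ q lam)) ?_ u r hr
      rintro y hy _ ⟨v, rfl⟩
      exact ⟨_, (groundMap_smul hy v).symm⟩
    · exact Submodule.subset_span
        ⟨[], groundState mu, ⟨Finsupp.single mu 1, rfl⟩, (one_smul _ _).symm⟩
  refine Submodule.span_le.mpr ?_ h1
  rintro _ ⟨w, _, ⟨v, rfl⟩, rfl⟩
  have h2 := groundMap_mem_span (k := k) (Δ := Δ) (q := q) v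
  rw [SetLike.mem_coe]
  generalize groundMap k Δ q lam v = x at h2
  induction h2 using Submodule.span_induction with
  | mem x hx => obtain ⟨mu, rfl⟩ := hx; exact Submodule.subset_span ⟨w, mu, rfl⟩
  | zero => rw [smul_zero]; exact zero_mem _
  | add a b _ _ ha hb => rw [smul_add]; exact add_mem ha hb
  | smul c a _ ha => rw [smul_algebra_smul_comm]; exact Submodule.smul_mem _ _ ha

lemma iota_posProj_mem_span (x : Affine) :
    (Affine.posProj x : Affine) ∈ Submodule.span ℂ (Set.range posLetter) := by
  induction x using Affine.affine_induction with
  | hadd x y hx hy => rw [map_add]; exact add_mem hx hy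
  | hK c =>
    rw [map_smul, Affine.posProj_eq_zero.mpr (fun n _ => by rw [Affine.loop_K, map_zero]),
      smul_zero]
    exact zero_mem _
  | hL c => rw [map_smul, Affine.posProj_L0, smul_zero]; exact zero_mem _
  | hmode n x =>
    rcases lt_or_ge 0 n with hn | hn
    · have h1 : (Affine.posProj (Affine.mode n x) : Affine) = Affine.mode n x :=
        congrArg Subtype.val (Affine.posProj_coe ⟨_, Affine.mode_mem_positive hn x⟩)
      rw [h1]
      refine mode_mem_of_gen (S := Submodule.span ℂ (Set.range posLetter))
        (fun i => Submodule.subset_span (Set.mem_range.mpr ⟨(i, (n - 1).toNat), ?_⟩)) x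
      simp only [posLetter]
      congr 1
      congr 1
      omega
    · rw [Affine.posProj_mode hn]; exact zero_mem _

/-- If `r` is mapped to `0` by the words in the modes of positive index followed by `toGround`,
then the submodule generated by `r` projects to `0`. -/
lemma toGround_smul_eq_zero_of_posWords {r : RelaxedVerma k Δ q lam}
    (hr : ∀ b, toGround k Δ q lam (wordProd posLetter b • r) = 0) (u : U) :
    toGround k Δ q lam (u • r) = 0 := by
  refine toGround_smul_eq_zero r (fun u => ?_) u
  revert r
  refine enveloping_induction_right
    { carrier := {u | ∀ {r : RelaxedVerma k Δ q lam},
        (∀ b, toGround k Δ q lam (wordProd posLetter b • r) = 0) → toGround k Δ q lam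
          (UniversalEnvelopingAlgebra.lift ℂ (iota.comp Affine.positive.incl) u • r) = 0}
      zero_mem' := fun _ => by rw [map_zero, zero_smul, map_zero]
      add_mem' := fun {a b} ha hb r hr => by
        rw [map_add, add_smul, map_add, ha hr, hb hr, add_zero]
      smul_mem' := fun c a ha r hr => by
        have h1 := map_smul (UniversalEnvelopingAlgebra.lift ℂ (iota.comp Affine.positive.incl)) c a
        rw [h1, smul_assoc, LinearMap.map_smul, ha hr, smul_zero] } ?_ ?_ u
  · intro r hr
    rw [map_one]; exact hr []
  · intro u hu x r hr
    rw [map_mul, mul_smul, UniversalEnvelopingAlgebra.lift_ι_apply]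
    -- `x` acts on `r` before the word `b` does, so a letter of `x` is appended at the right end of
    -- `b`.
    refine hu fun b => ?_
    have hx : (x : Affine) ∈ Submodule.span ℂ (Set.range posLetter) := by
      rw [← Affine.posProj_coe x]; exact iota_posProj_mem_span _
    change toGround k Δ q lam (wordProd posLetter b • iota (x : Affine) • r) = 0
    generalize (x : Affine) = y at hx
    induction hx using Submodule.span_induction with
    | mem y hy =>
      obtain ⟨a, rfl⟩ := hy
      have := hr (b ++ [a])
      rwa [wordProd_append, mul_smul, wordProd_cons, wordProd_nil, mul_one] at this
    | zero => rw [map_zero, zero_smul, smul_zero, map_zero]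
    | add y z _ _ hy hz => rw [map_add, add_smul, smul_add, map_add, hy, hz, add_zero]
    | smul c y _ hy =>
      have h1 := LinearMap.map_smul iota.toLinearMap c y
      rw [LieHom.coe_toLinearMap] at h1
      rw [h1, smul_assoc, smul_algebra_smul_comm, LinearMap.map_smul, hy, smul_zero]

end Ground

/-! ### The submodule `groundFree` -/

section GroundFree

variable {k Δ q : ℂ} {lam : WeightCoset}

/-- The largest submodule that projects to `0`. -/
def topFree (k Δ q : ℂ) (lam : WeightCoset) : Submodule U (RelaxedVerma k Δ q lam) where
  carrier := {r | ∀ u : U, toGround k Δ q lam (u • r) = 0}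
  zero_mem' u := by rw [smul_zero, map_zero]
  add_mem' {a b} ha hb u := by rw [smul_add, map_add, ha u, hb u, add_zero]
  smul_mem' c a ha u := by rw [← mul_smul]; exact ha _

lemma mem_topFree {r : RelaxedVerma k Δ q lam} :
    r ∈ topFree k Δ q lam ↔ ∀ u : U, toGround k Δ q lam (u • r) = 0 := Iff.rfl

/-- The product of the `L₀ - Δ - i` with `1 ≤ i ≤ m`. -/
def gradeKiller (Δ : ℂ) (m : ℕ) : U :=
  ((List.range m).map fun i : ℕ => iota Affine.L0 - (Δ + (i + 1)) • (1 : U)).prod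

lemma gradeKiller_smul {r : RelaxedVerma k Δ q lam} {t : ℂ} (hr : iota Affine.L0 • r = t • r)
    (m : ℕ) : gradeKiller Δ m • r =
      ((List.range m).map fun i : ℕ => t - (Δ + (i + 1))).prod • r := by
  induction m with
  | zero => simp [gradeKiller]
  | succ m ih =>
    rw [gradeKiller, List.range_succ, List.map_append, List.map_append, List.prod_append,
      List.prod_append, List.map_singleton, List.map_singleton, List.prod_singleton,
      List.prod_singleton, mul_smul, sub_smul, hr, smul_assoc, one_smul, ← sub_smul,
      smul_algebra_smul_comm, ← gradeKiller, ih, ← mul_smul, mul_comm]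

lemma gradeKiller_groundMap (v : Dense lam) (m : ℕ) :
    gradeKiller Δ m • groundMap k Δ q lam v =
      ((List.range m).map fun i : ℕ => Δ - (Δ + (i + 1))).prod • groundMap k Δ q lam v := by
  refine gradeKiller_smul ?_ m
  have h1 : groundMap k Δ q lam v ∈
      Module.End.eigenspace (Algebra.lsmul ℂ ℂ (RelaxedVerma k Δ q lam) (iota Affine.L0)) Δ := by
    refine Submodule.span_le.mpr ?_ (groundMap_mem_span v)
    rintro _ ⟨mu, rfl⟩
    rw [SetLike.mem_coe, Module.End.mem_eigenspace_iff]
    exact L0_smul_groundState mu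
  exact Module.End.mem_eigenspace_iff.mp h1

/-- Each component of `r` of positive grade is annihilated by one factor once `m` is large, which
leaves the ground component. -/
lemma exists_gradeKiller (r : RelaxedVerma k Δ q lam) : ∃ m₀, ∀ m ≥ m₀,
    gradeKiller Δ m • r = gradeKiller Δ m • groundMap k Δ q lam (toGround k Δ q lam r) := by
  induction mem_span_negWords r using Submodule.span_induction with
  | mem x hx =>
    obtain ⟨w, mu, rfl⟩ := hx
    cases w with
    | nil =>
      refine ⟨0, fun m _ => ?_⟩
      rw [wordProd_nil, one_smul, toGround_groundState]; rfl
    | cons a w =>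
      refine ⟨grade (a :: w), fun m hm => ?_⟩
      rw [gradeKiller_smul (L0_smul_negWord (L0_smul_groundState mu) _), wordProd_cons, mul_smul,
        toGround_negLetter, map_zero, smul_zero]
      have hpos : 0 < grade (a :: w) := by
        rw [grade, List.map_cons, List.sum_cons]; omega
      rw [List.prod_eq_zero, zero_smul]
      -- The factor with index `i` annihilates grade `i + 1`.
      refine List.mem_map.mpr ⟨grade (a :: w) - 1, List.mem_range.mpr (by omega), ?_⟩
      push_cast [Nat.cast_sub (show 1 ≤ grade (a :: w) from hpos)]
      ring
  | zero => exact ⟨0, fun m _ => by rw [map_zero, map_zero]⟩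
  | add a b _ _ ha hb =>
    obtain ⟨m, hm⟩ := ha
    obtain ⟨n, hn⟩ := hb
    refine ⟨max m n, fun l hl => ?_⟩
    rw [smul_add, hm l (le_trans (le_max_left _ _) hl), hn l (le_trans (le_max_right _ _) hl),
      map_add, map_add, smul_add]
  | smul c a _ ha =>
    obtain ⟨m, hm⟩ := ha
    refine ⟨m, fun l hl => ?_⟩
    rw [smul_algebra_smul_comm, hm l hl, LinearMap.map_smul, LinearMap.map_smul,
      smul_algebra_smul_comm]

/-- On ground states `gradeKiller` acts by the product of the numbers `-(i + 1)`, which is nonzero.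
Hence `N` contains the ground component of each of its elements, and this component must vanish. -/
lemma toGround_eq_zero_of_disjoint {N : Submodule U (RelaxedVerma k Δ q lam)}
    (hN : N.restrictScalars ℂ ⊓ LinearMap.range (groundMap k Δ q lam) = ⊥)
    {r : RelaxedVerma k Δ q lam} (hr : r ∈ N) : toGround k Δ q lam r = 0 := by
  obtain ⟨m, hm⟩ := exists_gradeKiller r
  have h1 := hm m le_rfl
  rw [gradeKiller_groundMap] at h1
  have h2 : ((List.range m).map fun i : ℕ => Δ - (Δ + (i + 1))).prod ≠ 0 := by
    rw [Ne, List.prod_eq_zero_iff, List.mem_map]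
    rintro ⟨i, _, hi⟩
    have : ((i + 1 : ℕ) : ℂ) = 0 := by push_cast; linear_combination -hi
    exact Nat.cast_ne_zero.mpr (Nat.succ_ne_zero i) this
  have h3 : groundMap k Δ q lam (toGround k Δ q lam r) ∈ N.restrictScalars ℂ := by
    have h4 := (N.restrictScalars ℂ).smul_mem
      ((List.range m).map fun i : ℕ => Δ - (Δ + (i + 1))).prod⁻¹ (N.smul_mem (gradeKiller Δ m) hr)
    rwa [h1, smul_smul, inv_mul_cancel₀ h2, one_smul] at h4
  have h5 : groundMap k Δ q lam (toGround k Δ q lam r) = 0 := by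
    rw [← Submodule.mem_bot (R := ℂ), ← hN]
    exact ⟨h3, _, rfl⟩
  rw [← toGround_groundMap (toGround k Δ q lam r), h5, map_zero]

/-- A submodule meeting the ground states trivially projects to zero together with all its
`U`-translates. Conversely `topFree` meets them trivially, since the projection is the identity on
ground states. -/
lemma groundFree_eq : groundFree k Δ q lam = topFree k Δ q lam := by
  apply le_antisymm
  · refine sSup_le fun N hN r hr u => ?_
    exact toGround_eq_zero_of_disjoint hN (N.smul_mem u hr)
  · refine le_sSup ?_
    rw [Set.mem_ofPred_eq, eq_bot_iff]
    rintro _ ⟨h1, v, rfl⟩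
    have h2 : toGround k Δ q lam ((1 : U) • groundMap k Δ q lam v) = 0 := h1 1
    rw [one_smul, toGround_groundMap] at h2
    rw [h2, map_zero]; exact zero_mem _

end GroundFree

/-! ### Weight spaces -/

section Eigen

variable {M ι : Type} [AddCommGroup M] [Module ℂ M]

/-- An eigenvector in the span of eigenvectors is in the span of those with its eigenvalue. -/
lemma mem_span_eigen (T : Module.End ℂ M) (v : ι → M) (t : ι → ℂ) (s : Set ι)
    (hv : ∀ i ∈ s, T (v i) = t i • v i) {x : M} (hx : x ∈ Submodule.span ℂ (v '' s)) {c : ℂ}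
    (hc : T x = c • x) : x ∈ Submodule.span ℂ (v '' {i ∈ s | t i = c}) := by
  have h1 : v '' s = v '' {i ∈ s | t i = c} ∪ v '' {i ∈ s | t i ≠ c} := by
    rw [← Set.image_union]
    congr 1
    ext i
    by_cases hi : t i = c <;> simp [hi]
  rw [h1, Submodule.span_union, Submodule.mem_sup] at hx
  obtain ⟨y, hy, z, hz, rfl⟩ := hx
  have hyc : y ∈ T.eigenspace c := by
    refine Submodule.span_le.mpr ?_ hy
    rintro _ ⟨i, ⟨hi, rfl⟩, rfl⟩
    exact Module.End.mem_eigenspace_iff.mpr (hv i hi)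
  have hzc : z ∈ T.eigenspace c := by
    have h2 : y + z ∈ T.eigenspace c := Module.End.mem_eigenspace_iff.mpr hc
    simpa using sub_mem h2 hyc
  -- `z` is an eigenvector for `c` and also lies in the sum of the other eigenspaces; these are
  -- independent, so `z = 0`.
  have hz' : z ∈ ⨆ d, ⨆ _ : d ≠ c, T.eigenspace d := by
    refine Submodule.span_le.mpr ?_ hz
    rintro _ ⟨i, ⟨hi, hic⟩, rfl⟩
    exact Submodule.mem_iSup_of_mem (t i) (Submodule.mem_iSup_of_mem hic
      (Module.End.mem_eigenspace_iff.mpr (hv i hi)))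
  have hz0 : z = 0 := Submodule.disjoint_def.mp (T.eigenspaces_iSupIndep c) z hzc hz'
  rwa [hz0, add_zero]

end Eigen

section WeightSpaces

variable {k Δ q : ℂ} {lam : WeightCoset}

/-- The image of a word applied to a ground state in the quotient module. -/
def wordVector (k Δ q : ℂ) (lam : WeightCoset) (i : List Letter × CosetWeight lam) :
    RelaxedModule k Δ q lam :=
  (groundFree k Δ q lam).mkQ (wordProd negLetter i.1 • groundState i.2)

/-- The word vectors span the quotient and are joint eigenvectors of `h_0` and `L₀`, so
`mem_span_eigen` applies once for each operator. -/
lemma weightSpace_eq_span (mu n : ℂ) : weightSpace (RelaxedModule k Δ q lam) mu n =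
    Submodule.span ℂ (wordVector k Δ q lam ''
      {i | i.2.val + 2 * wordWeight i.1 = mu ∧ Δ + grade i.1 = n}) := by
  have hh : ∀ i, Algebra.lsmul ℂ ℂ (RelaxedModule k Δ q lam) (iota (Affine.mode 0 h))
      (wordVector k Δ q lam i) = (i.2.val + 2 * wordWeight i.1 : ℂ) • wordVector k Δ q lam i := by
    intro i
    rw [Algebra.lsmul_apply, wordVector, ← map_smul, h_smul_negWord (h_smul_groundState i.2)]
    rfl
  have hL : ∀ i, Algebra.lsmul ℂ ℂ (RelaxedModule k Δ q lam) (iota Affine.L0)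
      (wordVector k Δ q lam i) = (Δ + grade i.1 : ℂ) • wordVector k Δ q lam i := by
    intro i
    rw [Algebra.lsmul_apply, wordVector, ← map_smul, L0_smul_negWord (L0_smul_groundState i.2)]
    rfl
  apply le_antisymm
  · rintro x ⟨hx1, hx2⟩
    have h0 : x ∈ Submodule.span ℂ (wordVector k Δ q lam '' Set.univ) := by
      clear hx1 hx2
      obtain ⟨r, rfl⟩ := Submodule.mkQ_surjective _ x
      induction mem_span_negWords r using Submodule.span_induction with
      | mem r hr =>
        obtain ⟨w, mu, rfl⟩ := hr
        exact Submodule.subset_span ⟨(w, mu), trivial, rfl⟩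
      | zero => rw [map_zero]; exact zero_mem _
      | add a b _ _ ha hb => rw [map_add]; exact add_mem ha hb
      | smul c a _ ha =>
        rw [LinearMap.map_smul_of_tower]; exact Submodule.smul_mem _ _ ha
    have h1 := mem_span_eigen _ _ _ _ (fun i _ => hh i) h0 (Module.End.mem_eigenspace_iff.mp hx1)
    have h2 := mem_span_eigen _ _ _ _ (fun i _ => hL i) h1 (Module.End.mem_eigenspace_iff.mp hx2)
    refine Submodule.span_mono (Set.image_mono ?_) h2
    rintro i ⟨⟨_, h3⟩, h4⟩
    exact ⟨h3, h4⟩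
  · rw [Submodule.span_le]
    rintro _ ⟨i, ⟨rfl, rfl⟩, rfl⟩
    exact ⟨Module.End.mem_eigenspace_iff.mpr (hh i), Module.End.mem_eigenspace_iff.mpr (hL i)⟩

lemma length_le_grade (w : List Letter) : w.length ≤ grade w := by
  induction w with
  | nil => simp
  | cons a w ih =>
    rw [grade, List.map_cons, List.sum_cons, ← grade, List.length_cons]; omega

lemma le_grade_of_mem {w : List Letter} {a : Letter} (ha : a ∈ w) : a.2 < grade w := by
  have := List.single_le_sum (fun _ _ => Nat.zero_le _) _
    (List.mem_map_of_mem (f := fun a : Letter => a.2 + 1) ha)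
  exact this

/-- The words of given grade. -/
abbrev Word (n : ℕ) : Type := {w : List Letter // grade w = n}

/-- Each letter contributes its index plus one to the grade, so a word of grade `n` has at most `n`
letters, all with index below `n`. -/
lemma finite_setOf_grade (n : ℕ) : {w : List Letter | grade w = n}.Finite := by
  have h1 : Set.Finite {w : List (Fin 3 × Fin n) | w.length ≤ n} := List.finite_length_le _ n
  refine (h1.image (List.map fun a => ((a.1, a.2.1) : Letter))).subset ?_
  intro w hw
  have hw' : grade w = n := hw
  refine ⟨w.attach.map fun a => (a.1.1, ⟨a.1.2, hw' ▸ le_grade_of_mem a.2⟩), ?_, ?_⟩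
  · rw [Set.mem_ofPred_eq, List.length_map, List.length_attach, ← hw']
    exact length_le_grade w
  · rw [List.map_map]
    exact List.attach_map_subtype_val w

instance (n : ℕ) : Finite (Word n) := (finite_setOf_grade n).to_subtype

instance (n : ℕ) : Fintype (Word n) := Fintype.ofFinite _

lemma finiteDimensional_weightSpace (mu n : ℂ) :
    FiniteDimensional ℂ (weightSpace (RelaxedModule k Δ q lam) mu n) := by
  rw [weightSpace_eq_span]
  refine FiniteDimensional.span_of_finite ℂ (Set.Finite.image _ ?_)
  by_cases hn : ∃ m : ℕ, Δ + m = n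
  · obtain ⟨m, rfl⟩ := hn
    -- The total weight and the word determine the ground state, so the first projection is
    -- injective here.
    refine Set.Finite.of_finite_image (f := Prod.fst)
      (Set.Finite.subset (finite_setOf_grade m) ?_) ?_
    · rintro _ ⟨i, ⟨_, hi⟩, rfl⟩
      exact_mod_cast add_left_cancel hi
    · rintro ⟨w, a⟩ ⟨ha, _⟩ ⟨w', b⟩ ⟨hb, _⟩ rfl
      simp only at ha hb
      rw [Prod.mk.injEq]
      refine ⟨rfl, CosetWeight.ext ?_⟩
      linear_combination ha - hb
  · convert Set.finite_empty
    rw [Set.eq_empty_iff_forall_notMem]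
    rintro i ⟨_, hi⟩
    exact hn ⟨_, hi⟩

end WeightSpaces

open Polynomial

/-! ### Ranks of polynomial matrices -/

section PolynomialMatrix

variable {m n : Type} [Fintype m] [Fintype n]

/-- A matrix of rank `r` is taken to an invertible `r × r` matrix by suitable matrices. -/
lemma exists_mul_mul_det_ne_zero (A : Matrix m n ℂ) :
    ∃ (P : Matrix (Fin A.rank) m ℂ) (Q : Matrix n (Fin A.rank) ℂ), (P * A * Q).det ≠ 0 := by
  classical
  let b : Module.Basis (Fin A.rank) ℂ (LinearMap.range A.mulVecLin) := Module.finBasis ℂ _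
  have hb : ∀ i, ∃ w, A.mulVecLin w = (b i : m → ℂ) := fun i => (b i).2
  choose w hw using hb
  obtain ⟨g, hg⟩ := (LinearMap.range A.mulVecLin).subtype.exists_leftInverse_of_injective
    (Submodule.ker_subtype _)
  let G : (m → ℂ) →ₗ[ℂ] (Fin A.rank → ℂ) := b.equivFun.toLinearMap ∘ₗ g
  refine ⟨LinearMap.toMatrix' G, Matrix.of fun j i => w i j, ?_⟩
  have h1 : LinearMap.toMatrix' G * A * Matrix.of (fun j i => w i j) = 1 := by
    ext i j
    have h2 : (LinearMap.toMatrix' G * A * Matrix.of fun j i => w i j) i j =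
        G (A.mulVec (w j)) i := by
      rw [← LinearMap.toMatrix'_mulVec G, Matrix.mulVec_mulVec]
      rfl
    have h3 : g (A.mulVec (w j)) = b j := by
      have h4 := LinearMap.congr_fun hg (b j)
      rw [LinearMap.comp_apply, Submodule.subtype_apply, ← hw j] at h4
      exact h4
    rw [h2]
    change b.equivFun (g _) i = _
    rw [h3, Module.Basis.equivFun_self, Matrix.one_apply]
    simp [eq_comm]
  rw [h1, Matrix.det_one]
  exact one_ne_zero

/-- The rank of a matrix of polynomials in one variable is constant outside a finite set. -/
lemma exists_generic_rank (A : Matrix m n ℂ[X]) : ∃ (r : ℕ) (E : Set ℂ), E.Finite ∧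
    ∀ z ∉ E, (A.map (eval z)).rank = r := by
  classical
  have hbdd : ∃ B, ∀ z : ℂ, (A.map (eval z)).rank ≤ B :=
    ⟨_, fun z => Matrix.rank_le_card_width _⟩
  -- The generic rank is the maximal one, attained at some `z₀`.
  obtain ⟨z₀, hz₀⟩ : ∃ z₀ : ℂ, ∀ z, (A.map (eval z)).rank ≤ (A.map (eval z₀)).rank := by
    obtain ⟨B, hB⟩ := hbdd
    have hfin : (Set.range fun z : ℂ => (A.map (eval z)).rank).Finite :=
      (Set.finite_Iic B).subset (by rintro _ ⟨z, rfl⟩; exact hB z)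
    obtain ⟨_, ⟨z₀, rfl⟩, hmax⟩ := hfin.exists_maximal (Set.range_nonempty _)
    exact ⟨z₀, fun z => by
      rcases le_total (A.map (eval z)).rank (A.map (eval z₀)).rank with hle | hle
      · exact hle
      · exact hmax ⟨z, rfl⟩ hle⟩
  obtain ⟨P, Q, hPQ⟩ := exists_mul_mul_det_ne_zero (A.map (eval z₀))
  -- `P` and `Q` compress the matrix to an invertible square one at `z₀`. The determinant `D` of the
  -- compressed polynomial matrix is therefore not the zero polynomial, and off its roots the rank
  -- is at least that at `z₀`.
  set D : ℂ[X] := (P.map C * A * Q.map C).det with hD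
  have heval : ∀ z, D.eval z = (P * A.map (eval z) * Q).det := by
    intro z
    rw [hD, ← coe_evalRingHom, RingHom.map_det, RingHom.mapMatrix_apply, Matrix.map_mul,
      Matrix.map_mul, Matrix.map_map, Matrix.map_map]
    congr 2
    · congr 1; ext i j; simp
    · ext i j; simp
  have hD0 : D ≠ 0 := by
    intro h0
    apply hPQ
    rw [← heval, h0, eval_zero]
  refine ⟨(A.map (eval z₀)).rank, D.roots.toFinset, Finset.finite_toSet _, fun z hz => ?_⟩
  refine le_antisymm (hz₀ z) ?_
  have h1 : (P * A.map (eval z) * Q).det ≠ 0 := by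
    rw [← heval]
    intro h0
    exact hz (by simpa [hD0] using h0)
  have h2 := Matrix.rank_of_det_ne_zero h1
  rw [Fintype.card_fin] at h2
  calc _ = (P * A.map (eval z) * Q).rank := h2.symm
    _ ≤ (P * A.map (eval z)).rank := Matrix.rank_mul_le_left _ _
    _ ≤ _ := Matrix.rank_mul_le_right _ _

end PolynomialMatrix

/-! ### Polynomial dependence on the weight -/

/-- A weight, as a weight of its own coset. -/
def base (mu : ℂ) : CosetWeight (mu : WeightCoset) := ⟨mu, rfl⟩

section Family

variable (k Δ q : ℂ)

/-- Families of vectors of relaxed Verma modules, indexed by the weights. -/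
def Family : Type := (mu : ℂ) → RelaxedVerma k Δ q (mu : WeightCoset)

instance : AddCommGroup (Family k Δ q) :=
  inferInstanceAs (AddCommGroup ((mu : ℂ) → RelaxedVerma k Δ q (mu : WeightCoset)))

instance : Module ℂ (Family k Δ q) :=
  inferInstanceAs (Module ℂ ((mu : ℂ) → RelaxedVerma k Δ q (mu : WeightCoset)))

instance : Module U (Family k Δ q) :=
  inferInstanceAs (Module U ((mu : ℂ) → RelaxedVerma k Δ q (mu : WeightCoset)))

instance : IsScalarTower ℂ U (Family k Δ q) where
  smul_assoc c u x := funext fun mu => smul_assoc c u (x mu)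

variable {k Δ q} in
lemma Family.add_apply (x y : Family k Δ q) (mu : ℂ) : (x + y) mu = x mu + y mu := rfl

variable {k Δ q} in
lemma Family.smul_apply (c : ℂ) (x : Family k Δ q) (mu : ℂ) : (c • x) mu = c • x mu := rfl

variable {k Δ q} in
lemma Family.U_smul_apply (u : U) (x : Family k Δ q) (mu : ℂ) : (u • x) mu = u • x mu := rfl

variable {k Δ q} in
lemma Family.zero_apply (mu : ℂ) : (0 : Family k Δ q) mu = 0 := rfl

/-- The family `μ ↦ p(μ) v_{μ+sα}`. -/
def groundFamily (p : ℂ[X]) (s : ℤ) : Family k Δ q :=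
  fun mu => p.eval mu • groundState ((base mu).shift s)

/-- The span of the families `μ ↦ p(μ) v_{μ+sα}`. -/
def groundFamilies : Submodule ℂ (Family k Δ q) :=
  Submodule.span ℂ {x | ∃ p s, x = groundFamily k Δ q p s}

variable {k Δ q}

lemma groundFamily_mem (p : ℂ[X]) (s : ℤ) : groundFamily k Δ q p s ∈ groundFamilies k Δ q :=
  Submodule.subset_span ⟨p, s, rfl⟩

/-- The coefficients of the action on ground states, `γ` included, are polynomials in the weight.
Collecting the modules over all weights in one `U`-module makes `word_span_stable` applicable to
polynomial families. -/
lemma smul_groundFamilies {y : Affine} (hy : y ∈ Affine.nonneg) {x : Family k Δ q}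
    (hx : x ∈ groundFamilies k Δ q) : iota y • x ∈ groundFamilies k Δ q := by
  induction hx using Submodule.span_induction with
  | mem x hx =>
    obtain ⟨p, s, rfl⟩ := hx
    -- The three families are the diagonal part (`h`, `K`, `L₀`), the `e` part and the `f` part; `X
    -- + C (s * 2)` is the weight `μ + sα`, and the second coefficient contains `γ` at that weight.
    have h1 : iota y • groundFamily k Δ q p s =
        groundFamily k Δ q (p * (C ((loopCoeff 0 y.loop).1 0 0) * (X + C ((s : ℂ) * 2)) +
          C (k * y.central + Δ * y.deriv))) s +
        groundFamily k Δ q (p * (C ((loopCoeff 0 y.loop).1 0 1) *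
          (C (1 / 2) * (C q - C (1 / 2) * (X + C ((s : ℂ) * 2)) * (X + C ((s : ℂ) * 2) + 2))))) (s + 1) +
        groundFamily k Δ q (p * C ((loopCoeff 0 y.loop).1 1 0)) (s + -1) := by
      funext mu
      rw [Family.U_smul_apply, Family.add_apply, Family.add_apply]
      simp only [groundFamily]
      rw [smul_algebra_smul_comm, smul_groundState hy]
      simp only [smul_add, smul_smul, CosetWeight.shift_shift]
      simp only [eval_mul, eval_add, eval_sub, eval_C, eval_X, eval_ofNat, CosetWeight.val_shift]
      congr 3
      simp only [gamma, casimirValue, base, CosetWeight.val]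
      ring
    rw [h1]
    exact add_mem (add_mem (groundFamily_mem _ _) (groundFamily_mem _ _)) (groundFamily_mem _ _)
  | zero => rw [smul_zero]; exact zero_mem _
  | add a b _ _ ha hb => rw [smul_add]; exact add_mem ha hb
  | smul c a _ ha => rw [smul_algebra_smul_comm]; exact Submodule.smul_mem _ _ ha

/-- The family `μ ↦ u v_μ`. -/
def cyclicFamily (k Δ q : ℂ) (u : U) : Family k Δ q := fun mu => u • groundState (base mu)

lemma cyclicFamily_mem_span (u : U) : cyclicFamily k Δ q u ∈ Submodule.span ℂ
      {m | ∃ w, ∃ x ∈ groundFamilies k Δ q, m = wordProd negLetter w • x} := by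
  have h1 : cyclicFamily k Δ q u = u • groundFamily k Δ q 1 0 := by
    funext mu
    rw [cyclicFamily, Family.U_smul_apply, groundFamily, eval_one, one_smul, CosetWeight.shift_zero]
  rw [h1]
  refine word_span_stable negLetter (Affine.nonneg : Set Affine) mem_span_negLetter
    (groundFamilies k Δ q) (fun y hy x hx => smul_groundFamilies hy hx) u _ ?_
  exact Submodule.subset_span ⟨[], _, groundFamily_mem _ _, (one_smul _ _).symm⟩

lemma shift_injective {lam : WeightCoset} (mu : CosetWeight lam) {s t : ℤ}
    (hst : mu.shift s = mu.shift t) : s = t := by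
  have h1 := congrArg CosetWeight.val hst
  rw [CosetWeight.val_shift, CosetWeight.val_shift] at h1
  have h2 : (s : ℂ) = t := by linear_combination h1 / 2
  exact_mod_cast h2

/-- The families whose projections to the ground states have polynomial coefficients. -/
def polynomialFamilies (k Δ q : ℂ) : Submodule ℂ (Family k Δ q) where
  carrier := {x | ∀ s : ℤ, ∃ p : ℂ[X], ∀ mu : ℂ,
    toGround k Δ q mu (x mu) ((base mu).shift s) = p.eval mu}
  zero_mem' s := ⟨0, fun mu => by
    rw [Family.zero_apply, map_zero, Finsupp.zero_apply, eval_zero]⟩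
  add_mem' {a b} ha hb s := by
    obtain ⟨p, hp⟩ := ha s
    obtain ⟨p', hp'⟩ := hb s
    exact ⟨p + p', fun mu => by
      rw [Family.add_apply, map_add, Finsupp.add_apply, hp, hp', eval_add]⟩
  smul_mem' c a ha s := by
    obtain ⟨p, hp⟩ := ha s
    exact ⟨c • p, fun mu => by
      rw [Family.smul_apply, map_smul, Finsupp.smul_apply, hp, eval_smul]⟩

/-- The coefficients of the projection of `u v_μ` to the ground states are polynomials in `μ`. -/
lemma exists_coeff_polynomial (k Δ q : ℂ) (u : U) (s : ℤ) : ∃ p : ℂ[X], ∀ mu : ℂ,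
    toGround k Δ q mu (u • groundState (base mu)) ((base mu).shift s) = p.eval mu := by
  classical
  have h1 : cyclicFamily k Δ q u ∈ polynomialFamilies k Δ q := by
    refine Submodule.span_le.mpr ?_ (cyclicFamily_mem_span u)
    rintro _ ⟨w, x, hx, rfl⟩
    -- A nonempty word of negative modes projects to zero; the empty word leaves a polynomial
    -- family.
    cases w with
    | cons a w =>
      intro s
      refine ⟨0, fun mu => ?_⟩
      rw [Family.U_smul_apply, wordProd_cons, mul_smul, toGround_negLetter]
      simp
    | nil =>
      rw [wordProd_nil, one_smul]
      refine Submodule.span_le.mpr ?_ hx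
      rintro _ ⟨p, t, rfl⟩ s
      refine ⟨if t = s then p else 0, fun mu => ?_⟩
      rw [groundFamily, map_smul, toGround_groundState, Finsupp.smul_apply,
        Finsupp.single_apply]
      by_cases hts : t = s
      · simp [hts]
      · rw [if_neg fun hh => hts (shift_injective _ hh)]
        simp [hts]
  exact h1 s

end Family

/-! ### String functions -/

/-- One polynomial serves all cosets, because the families run over all complex weights, each placed
in its own coset. This is the source of the independence of `λ`. -/
lemma exists_coeff_polynomial_coset (k Δ q : ℂ) (u : U) (s : ℤ) : ∃ p : ℂ[X],
    ∀ (lam : WeightCoset) (mu : CosetWeight lam),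
      toGround k Δ q lam (u • groundState mu) (mu.shift s) = p.eval mu.val := by
  obtain ⟨p, hp⟩ := exists_coeff_polynomial k Δ q u s
  refine ⟨p, fun lam mu => ?_⟩
  obtain ⟨m, rfl⟩ := mu
  exact hp m

section Strings

variable {k Δ q : ℂ} {lam : WeightCoset}

lemma denseH_apply (d : Dense lam) (mu : CosetWeight lam) : denseH lam d mu = mu.val * d mu := by
  classical
  induction d using Finsupp.induction_linear with
  | zero => simp
  | add a b ha hb => rw [map_add, Finsupp.add_apply, ha, hb, Finsupp.add_apply, mul_add]
  | single nu c =>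
    rw [denseH, Finsupp.linearCombination_single, Finsupp.smul_apply, Finsupp.single_apply,
      Finsupp.single_apply]
    split_ifs with hh
    · subst hh; rw [smul_eq_mul, mul_comm]
    · simp

lemma topRep_mode_zero (x : sl2) : topRep k Δ q lam (Affine.mode 0 x) =
    x.1 0 0 • denseH lam + x.1 0 1 • denseE q lam + x.1 1 0 • denseF lam := by
  rw [topRep_apply, loopCoeff_zero_mode_zero, Affine.mode_central, Affine.mode_deriv, mul_zero,
    mul_zero, add_zero, zero_smul, add_zero]
  rfl

lemma topRep_h : topRep k Δ q lam (Affine.mode 0 h) = denseH lam := by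
  rw [topRep_mode_zero, h_coe]; simp

lemma topRep_L0_apply (d : Dense lam) : topRep k Δ q lam Affine.L0 d = Δ • d := by
  rw [topRep_apply, Affine.loop_L0, map_zero, map_zero, zero_add]
  change (k * 0 + Δ * 1) • d = _
  rw [mul_zero, mul_one, zero_add]

lemma toGround_apply_of_weight {r : RelaxedVerma k Δ q lam} {t : ℂ}
    (hr : iota (Affine.mode 0 h) • r = t • r) {mu : CosetWeight lam} (hmu : mu.val ≠ t) :
    toGround k Δ q lam r mu = 0 := by
  have h1 := toGround_smul (k := k) (Δ := Δ) (q := q)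
    (Affine.posProj_mode (le_refl (0 : ℤ)) h) r
  rw [hr, topRep_h, LinearMap.map_smul] at h1
  have h2 := DFunLike.congr_fun h1 mu
  rw [denseH_apply, Finsupp.smul_apply, smul_eq_mul] at h2
  have h3 : (mu.val - t) * toGround k Δ q lam r mu = 0 := by linear_combination -h2
  exact (mul_eq_zero.mp h3).resolve_left (sub_ne_zero.mpr hmu)

lemma toGround_of_grade {r : RelaxedVerma k Δ q lam} {t : ℂ}
    (hr : iota Affine.L0 • r = t • r) (ht : t ≠ Δ) : toGround k Δ q lam r = 0 := by
  have h1 := toGround_smul (k := k) (Δ := Δ) (q := q) Affine.posProj_L0 r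
  rw [hr, topRep_L0_apply, LinearMap.map_smul, ← sub_eq_zero, ← sub_smul] at h1
  exact (smul_eq_zero.mp h1).resolve_left (sub_ne_zero.mpr ht)

/-- The words of grade `n` applied to ground states so as to have weight `ν`. -/
def wordState (k Δ q : ℂ) (nu : CosetWeight lam) {n : ℕ} (w : Word n) : RelaxedVerma k Δ q lam :=
  wordProd negLetter w.1 • groundState (nu.shift (-wordWeight w.1))

/-- The pairing of the words in negative modes with the words in positive modes. -/
def pairingMatrix (k Δ q : ℂ) (nu : CosetWeight lam) (n : ℕ) : Matrix (Word n) (Word n) ℂ :=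
  Matrix.of fun b w => toGround k Δ q lam (wordProd posLetter b.1 • wordState k Δ q nu w)
    (nu.shift (wordWeight b.1))

lemma exists_pairing_polynomial (k Δ q : ℂ) (n : ℕ) : ∃ A : Matrix (Word n) (Word n) ℂ[X],
    ∀ (lam : WeightCoset) (nu : CosetWeight lam),
      pairingMatrix k Δ q nu n = A.map (eval nu.val) := by
  choose p hp using fun b w : Word n => exists_coeff_polynomial_coset k Δ q
    (wordProd posLetter b.1 * wordProd negLetter w.1) (wordWeight b.1 + wordWeight w.1)
  -- The word `w` is applied to the ground state of weight `ν - wt(w) α`, hence the substitution.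
  refine ⟨Matrix.of fun b w => (p b w).comp (X - C (2 * (wordWeight w.1 : ℂ))),
    fun lam nu => ?_⟩
  ext b w
  have h1 := hp b w lam (nu.shift (-wordWeight w.1))
  rw [CosetWeight.shift_shift, mul_smul, CosetWeight.val_shift] at h1
  have h2 : -wordWeight w.1 + (wordWeight b.1 + wordWeight w.1) = wordWeight b.1 := by ring
  rw [h2] at h1
  rw [pairingMatrix, Matrix.of_apply, wordState, h1, Matrix.map_apply, Matrix.of_apply, eval_comp]
  congr 1
  simp
  ring

/-- The linear combinations of the words of grade `n` and weight `ν`. -/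
def wordCombination (k Δ q : ℂ) (nu : CosetWeight lam) (n : ℕ) :
    (Word n → ℂ) →ₗ[ℂ] RelaxedVerma k Δ q lam :=
  Fintype.linearCombination ℂ (wordState k Δ q nu)

lemma h_smul_wordCombination (nu : CosetWeight lam) (n : ℕ) (c : Word n → ℂ) :
    iota (Affine.mode 0 h) • wordCombination k Δ q nu n c =
      nu.val • wordCombination k Δ q nu n c := by
  rw [wordCombination, Fintype.linearCombination_apply, Finset.smul_sum, Finset.smul_sum]
  refine Finset.sum_congr rfl fun w _ => ?_
  rw [smul_algebra_smul_comm, wordState, h_smul_negWord (h_smul_groundState _),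
    CosetWeight.val_shift, smul_comm (c w)]
  congr 2
  push_cast; ring

lemma L0_smul_wordCombination (nu : CosetWeight lam) (n : ℕ) (c : Word n → ℂ) :
    iota Affine.L0 • wordCombination k Δ q nu n c =
      (Δ + n) • wordCombination k Δ q nu n c := by
  rw [wordCombination, Fintype.linearCombination_apply, Finset.smul_sum, Finset.smul_sum]
  refine Finset.sum_congr rfl fun w _ => ?_
  rw [smul_algebra_smul_comm, wordState, L0_smul_negWord (L0_smul_groundState _), w.2,
    smul_comm (c w)]

/-- Words in positive modes suffice to test membership. A word of grade other than `n` leads to a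
conformal weight different from `Δ`, so its projection is zero. A word `b` of grade `n` leads to the
single ground weight `ν + wt(b) α`, whose coefficient is an entry of the matrix-vector product. -/
lemma wordCombination_mem_groundFree (nu : CosetWeight lam) (n : ℕ) (c : Word n → ℂ) :
    wordCombination k Δ q nu n c ∈ groundFree k Δ q lam ↔
      (pairingMatrix k Δ q nu n).mulVec c = 0 := by
  have hentry : ∀ b : Word n, (pairingMatrix k Δ q nu n).mulVec c b =
      toGround k Δ q lam (wordProd posLetter b.1 • wordCombination k Δ q nu n c)
        (nu.shift (wordWeight b.1)) := by
    intro b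
    rw [wordCombination, Fintype.linearCombination_apply, Finset.smul_sum, map_sum,
      Finsupp.finsetSum_apply]
    refine Finset.sum_congr rfl fun w _ => ?_
    rw [smul_algebra_smul_comm, LinearMap.map_smul, Finsupp.smul_apply, smul_eq_mul, mul_comm]
    rfl
  rw [groundFree_eq, mem_topFree]
  constructor
  · intro hx
    funext b
    rw [hentry, hx]; rfl
  · intro hx
    refine toGround_smul_eq_zero_of_posWords fun b => ?_
    by_cases hb : grade b = n
    · ext mu
      by_cases hmu : mu = nu.shift (wordWeight b)
      · rw [hmu, ← hentry ⟨b, hb⟩, hx]; rfl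
      · refine toGround_apply_of_weight
          (h_smul_posWord (h_smul_wordCombination nu n c) b) fun hval => hmu ?_
        apply CosetWeight.ext
        rw [hval, CosetWeight.val_shift, mul_comm]
    · refine toGround_of_grade (L0_smul_posWord (L0_smul_wordCombination nu n c) b) fun hΔ => hb ?_
      have h1 : (n : ℂ) = grade b := by linear_combination hΔ
      exact_mod_cast h1.symm

lemma range_wordCombination (nu : CosetWeight lam) (n : ℕ) :
    LinearMap.range (((groundFree k Δ q lam).mkQ.restrictScalars ℂ) ∘ₗ
      wordCombination k Δ q nu n) =
      weightSpace (RelaxedModule k Δ q lam) nu.val (Δ + n) := by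
  rw [weightSpace_eq_span, LinearMap.range_comp, wordCombination,
    Fintype.range_linearCombination, Submodule.map_span]
  congr 1
  ext x
  constructor
  · rintro ⟨_, ⟨w, rfl⟩, rfl⟩
    refine ⟨(w.1, nu.shift (-wordWeight w.1)), ⟨?_, ?_⟩, rfl⟩
    · rw [CosetWeight.val_shift]
      push_cast; ring
    · simp only [w.2]
  · rintro ⟨⟨w, mu⟩, ⟨h1, h2⟩, rfl⟩
    have h3 : grade w = n := by exact_mod_cast add_left_cancel h2
    refine ⟨_, ⟨⟨w, h3⟩, rfl⟩, ?_⟩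
    have h4 : nu.shift (-wordWeight w) = mu := by
      apply CosetWeight.ext
      rw [CosetWeight.val_shift, ← h1]
      push_cast; ring
    change (groundFree k Δ q lam).mkQ (wordProd negLetter w • groundState (nu.shift _)) = _
    rw [h4]; rfl

/-- Coefficient vectors map onto the weight space, with the same kernel as the pairing matrix;
rank-nullity concludes. The word vectors need not be linearly independent. -/
lemma stringFunction_eq_rank (nu : CosetWeight lam) (n : ℕ) :
    stringFunction (RelaxedModule k Δ q lam) nu.val (Δ + n) = (pairingMatrix k Δ q nu n).rank := by
  rw [stringFunction, ← range_wordCombination, Matrix.rank]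
  set Θ := ((groundFree k Δ q lam).mkQ.restrictScalars ℂ) ∘ₗ wordCombination k Δ q nu n with hΘ
  have hker : LinearMap.ker Θ = LinearMap.ker (pairingMatrix k Δ q nu n).mulVecLin := by
    ext c
    rw [LinearMap.mem_ker, LinearMap.mem_ker, Matrix.mulVecLin_apply,
      ← wordCombination_mem_groundFree]
    exact Submodule.Quotient.mk_eq_zero _
  have h1 := Θ.finrank_range_add_finrank_ker
  have h2 := (pairingMatrix k Δ q nu n).mulVecLin.finrank_range_add_finrank_ker
  rw [hker] at h1
  exact Nat.add_right_cancel (h1.trans h2.symm)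

lemma stringFunction_eq_zero (mu n : ℂ) (hn : ∀ m : ℕ, n ≠ Δ + m) :
    stringFunction (RelaxedModule k Δ q lam) mu n = 0 := by
  have h1 : {i : List Letter × CosetWeight lam |
      i.2.val + 2 * wordWeight i.1 = mu ∧ Δ + grade i.1 = n} = ∅ := by
    rw [Set.eq_empty_iff_forall_notMem]
    rintro i ⟨_, hi⟩
    exact hn _ hi.symm
  rw [stringFunction, weightSpace_eq_span, h1, Set.image_empty, Submodule.span_empty, finrank_bot]

end Strings

/-! ### Limits of the string functions -/

lemma eventually_shift_notMem {lam : WeightCoset} (mu : CosetWeight lam) {E : Set ℂ}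
    (hE : E.Finite) : ∀ᶠ m : ℤ in Filter.atTop, (mu.shift m).val ∉ E := by
  have hinj : Function.Injective fun m : ℤ => (mu.shift m).val :=
    fun a b hab => shift_injective mu (CosetWeight.ext hab)
  have h1 : ∀ᶠ m : ℤ in Filter.cofinite, (mu.shift m).val ∉ E :=
    (hE.preimage hinj.injOn).eventually_cofinite_notMem
  rw [Int.cofinite_eq] at h1
  exact (Filter.eventually_sup.mp h1).2

/-- The positive limiting string functions exist and do not depend on the coset. -/
theorem exists_limitingStringFunction (k Δ q : ℂ) : ∃ S : ℂ → ℕ, ∀ lam : WeightCoset,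
    IsPositiveLimitingStringFunction (RelaxedModule k Δ q lam) lam S := by
  classical
  choose A hA using exists_pairing_polynomial k Δ q
  choose r E hE hr using fun n => exists_generic_rank (A n)
  -- The limit has the generic rank of grade `n` at exponent `Δ + n`, and zero at every exponent not
  -- of this form.
  refine ⟨fun c => if hc : ∃ n : ℕ, c = Δ + n then r hc.choose else 0, fun lam mu c => ?_⟩
  refine tendsto_const_nhds.congr' ?_
  by_cases hc : ∃ n : ℕ, c = Δ + n
  · filter_upwards [eventually_shift_notMem mu (hE hc.choose)] with m hm
    rw [dif_pos hc]
    conv_rhs => rw [hc.choose_spec]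
    rw [stringFunction_eq_rank, hA, hr _ _ hm]
  · refine Filter.Eventually.of_forall fun m => ?_
    simp only
    rw [dif_neg hc, stringFunction_eq_zero _ _ fun n hn => hc ⟨n, hn⟩]

/-! ### The adjoint -/

lemma transpose_coe (x : sl2) : (transpose x).1 = x.1.transpose := rfl

lemma transpose_transpose (x : sl2) : transpose (transpose x) = x :=
  Subtype.ext (Matrix.transpose_transpose x.1)

lemma transpose_lie (x y : sl2) : transpose ⁅x, y⁆ = ⁅transpose y, transpose x⁆ := by
  apply Subtype.ext
  rw [transpose_coe, LieAlgebra.SpecialLinear.sl_bracket, LieAlgebra.SpecialLinear.sl_bracket,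
    transpose_coe, transpose_coe, Matrix.transpose_sub, Matrix.transpose_mul, Matrix.transpose_mul]

lemma killing_transpose (x y : sl2) : killing (transpose y) (transpose x) = killing x y := by
  rw [killing_apply, killing_apply, transpose_coe, transpose_coe, ← Matrix.transpose_mul,
    Matrix.trace_transpose]

lemma transpose_e : transpose e = f := Subtype.ext (by
  rw [transpose_coe, e_coe, f_coe]; ext i j; fin_cases i <;> fin_cases j <;> rfl)

lemma transpose_f : transpose f = e := by rw [← transpose_e, transpose_transpose]

lemma transpose_h : transpose h = h := Subtype.ext (by
  rw [transpose_coe, h_coe]; ext i j; fin_cases i <;> fin_cases j <;> rfl)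

namespace Affine

lemma dagger_K : dagger K = K := by
  ext1
  · change Finsupp.lsum ℂ _ (LieAlgebra.LoopAlgebra.toFinsupp ℂ ℤ sl2 0) = 0
    rw [map_zero, map_zero]
  · rfl
  · rfl

lemma dagger_L0 : dagger L0 = L0 := by
  ext1
  · change Finsupp.lsum ℂ _ (LieAlgebra.LoopAlgebra.toFinsupp ℂ ℤ sl2 0) = 0
    rw [map_zero, map_zero]
  · rfl
  · rfl

lemma dagger_dagger (x : Affine) : dagger (dagger x) = x := by
  induction x using affine_induction with
  | hadd x y hx hy => rw [map_add, map_add, hx, hy]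
  | hK c => rw [map_smul, map_smul, dagger_K, dagger_K]
  | hL c => rw [map_smul, map_smul, dagger_L0, dagger_L0]
  | hmode n x => rw [dagger_mode, dagger_mode, neg_neg, transpose_transpose]

lemma lie_K (x : Affine) : ⁅x, K⁆ = 0 := by rw [← lie_skew, K_lie, neg_zero]

lemma mode_lie_L0 (n : ℤ) (x : sl2) : ⁅mode n x, L0⁆ = (n : ℂ) • mode n x := by
  rw [← lie_skew, L0_lie_mode, neg_smul, neg_neg]

lemma dagger_lie (x y : Affine) : dagger ⁅x, y⁆ = ⁅dagger y, dagger x⁆ := by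
  induction x using affine_induction with
  | hadd x x' hx hx' => rw [add_lie, map_add, hx, hx', map_add, lie_add]
  | hK c => rw [smul_lie, K_lie, map_smul, map_smul, dagger_K, lie_smul, lie_K, map_zero]
  | hL c =>
    rw [smul_lie, map_smul, map_smul, dagger_L0, lie_smul]
    congr 1
    induction y using affine_induction with
    | hadd y y' hy hy' => rw [lie_add, map_add, hy, hy', map_add, add_lie]
    | hK c => rw [lie_smul, lie_K, map_smul, map_smul, dagger_K, smul_lie, K_lie, map_zero]
    | hL c => rw [lie_smul, lie_self, map_smul, map_smul, dagger_L0, smul_lie, lie_self, map_zero]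
    | hmode n y =>
      rw [L0_lie_mode, map_smul, dagger_mode, mode_lie_L0]
      push_cast; rfl
  | hmode m x =>
    induction y using affine_induction with
    | hadd y y' hy hy' => rw [lie_add, map_add, hy, hy', map_add, add_lie]
    | hK c => rw [lie_smul, lie_K, map_smul, map_smul, dagger_K, smul_lie, K_lie, map_zero]
    | hL c =>
      rw [lie_smul, map_smul, map_smul, dagger_L0, smul_lie, mode_lie_L0, map_smul, dagger_mode,
        L0_lie_mode]
      push_cast; rw [neg_neg]
    | hmode n y =>
      rw [mode_lie_mode, map_add, dagger_mode, dagger_mode, dagger_mode, mode_lie_mode,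
        transpose_lie, killing_transpose]
      have h1 : -(m + n) = -n + -m := by ring
      rw [h1]
      -- The central terms carry the factors `m` and `-n`, which agree when `m + n = 0`.
      by_cases hmn : m + n = 0
      · have h2 : -n + -m = 0 := by omega
        have h3 : m = -n := by omega
        rw [if_pos hmn, if_pos h2, map_smul, dagger_K, h3]
      · have h2 : ¬ -n + -m = 0 := by omega
        rw [if_neg hmn, if_neg h2, map_zero]

lemma loopCoeff_dagger (n : ℤ) (x : Affine) :
    loopCoeff n (dagger x).loop = transpose (loopCoeff (-n) x.loop) := by
  induction x using affine_induction with
  | hadd x y hx hy => rw [map_add, loop_add, map_add, hx, hy, loop_add, map_add, map_add]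
  | hK c => rw [map_smul, dagger_K, loop_smul, loop_K, smul_zero, map_zero, map_zero, map_zero]
  | hL c => rw [map_smul, dagger_L0, loop_smul, loop_L0, smul_zero, map_zero, map_zero, map_zero]
  | hmode m x =>
    rw [dagger_mode, mode_loop, mode_loop, loopCoeff_loopMode, loopCoeff_loopMode]
    by_cases hm : m = -n
    · rw [if_pos hm, if_pos (by omega)]
    · rw [if_neg hm, if_neg (by omega), map_zero]

lemma posProj_dagger {y : Affine} (hy : y ∈ nonneg) : posProj (dagger y) = 0 := by
  rw [posProj_eq_zero]
  intro n hn
  rw [loopCoeff_dagger, hy (-n) (by omega), map_zero]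

lemma dagger_negLetter_mem (a : Letter) : dagger (negLetter a) ∈ positive := by
  rw [negLetter, dagger_mode]
  exact mode_mem_positive (by omega) _

end Affine

section DualRep

variable (M : Type) [AddCommGroup M] [Module ℂ M] [Module U M] [IsScalarTower ℂ U M]

/-- The contragredient representation on the dual of a module. -/
def dualRep : Affine →ₗ⁅ℂ⁆ Module.End ℂ (Module.Dual ℂ M) where
  toFun x := (Algebra.lsmul ℂ ℂ M (iota (Affine.dagger x))).dualMap
  map_add' x y := by
    ext ψ m
    simp only [LinearMap.dualMap_apply, LinearMap.add_apply, Algebra.lsmul_apply]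
    rw [map_add, map_add, add_smul, map_add]
  map_smul' c x := by
    ext ψ m
    simp only [LinearMap.dualMap_apply, LinearMap.smul_apply, Algebra.lsmul_apply,
      RingHom.id_apply]
    have h1 := LinearMap.map_smul iota.toLinearMap c (Affine.dagger x)
    rw [LieHom.coe_toLinearMap] at h1
    rw [LinearMap.map_smul Affine.dagger, h1, smul_assoc, LinearMap.map_smul]
  map_lie' {x y} := by
    ext ψ m
    simp only [LinearMap.dualMap_apply, Ring.lie_def, LinearMap.sub_apply,
      Module.End.mul_apply, Algebra.lsmul_apply]
    rw [Affine.dagger_lie, LieHom.map_lie, Ring.lie_def, sub_smul, map_sub, mul_smul, mul_smul]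

lemma dualRep_apply (x : Affine) (ψ : Module.Dual ℂ M) (m : M) :
    dualRep M x ψ m = ψ (iota (Affine.dagger x) • m) := rfl

end DualRep

/-! ### Existence of the Shapovalov form -/

section Existence

variable {k Δ q : ℂ} {lam : WeightCoset}

lemma exists_shift (xi mu : CosetWeight lam) : ∃ s : ℤ, mu = xi.shift s := by
  have h1 : ((xi.val : ℂ) : WeightCoset) = (mu.val : ℂ) := xi.2.trans mu.2.symm
  rw [QuotientAddGroup.eq] at h1
  obtain ⟨s, hs⟩ := h1
  refine ⟨s, CosetWeight.ext ?_⟩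
  rw [CosetWeight.val_shift]
  simp only [zsmul_eq_mul] at hs
  linear_combination -hs

/-- A zero of `γ` at `ξ + jα` would be a solution of the Casimir equation in the coset with real
part at least that of `ξ`. -/
lemma gamma_ne_zero {xi : CosetWeight lam} (hxi : IsGenerating q xi) (j : ℕ) :
    gamma q (xi.shift j).val ≠ 0 := by
  intro h0
  have h1 : casimirValue (xi.shift j).val = q := by
    rw [gamma] at h0; linear_combination -2 * h0
  have h2 := hxi _ h1
  rw [CosetWeight.val_shift] at h2
  simp only [Int.cast_natCast, Complex.add_re, Complex.mul_re, Complex.natCast_re, Complex.re_ofNat,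
    Complex.natCast_im, Complex.im_ofNat, mul_zero, sub_zero] at h2
  have h3 : (0 : ℝ) ≤ j := Nat.cast_nonneg j
  linarith

/-- Going up from `0` divides by `g` and going down multiplies by it, so only the values at
nonnegative integers must be nonzero. In the formula at least one of the two products is empty. -/
lemma exists_int_recursion (g : ℤ → ℂ) (hg : ∀ j : ℕ, g j ≠ 0) :
    ∃ c : ℤ → ℂ, c 0 = 1 ∧ ∀ s, c s = g s * c (s + 1) := by
  refine ⟨fun s => (∏ j ∈ Finset.range s.toNat, (g j)⁻¹) *
    ∏ j ∈ Finset.range (-s).toNat, g (-(j + 1)), by simp, fun s => ?_⟩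
  simp only
  rcases le_or_gt 0 s with hs | hs
  · obtain ⟨j, rfl⟩ := Int.eq_ofNat_of_zero_le hs
    have h1 : (-(j : ℤ)).toNat = 0 := by omega
    have h2 : (-((j : ℤ) + 1)).toNat = 0 := by omega
    have h3 : ((j : ℤ) + 1).toNat = j + 1 := by omega
    rw [h1, h2, h3, Int.toNat_natCast, Finset.prod_range_succ]
    field_simp [hg j]
  · obtain ⟨j, rfl⟩ : ∃ j : ℕ, s = -(j + 1) := ⟨(-s - 1).toNat, by omega⟩
    have h1 : (-(-((j : ℤ) + 1))).toNat = j + 1 := by omega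
    have h2 : (-(-((j : ℤ) + 1) + 1)).toNat = j := by omega
    have h3 : (-((j : ℤ) + 1)).toNat = 0 := by omega
    have h4 : (-((j : ℤ) + 1) + 1).toNat = 0 := by omega
    rw [h1, h2, h3, h4, Finset.prod_range_succ]
    ring

/-- The norms of the ground states of a Shapovalov form. -/
lemma exists_norms {xi : CosetWeight lam} (hxi : IsGenerating q xi) :
    ∃ c : CosetWeight lam → ℂ, c xi = 1 ∧ ∀ mu, c mu = gamma q mu.val * c (mu.shift 1) := by
  obtain ⟨c, hc0, hc⟩ := exists_int_recursion (fun s => gamma q (xi.shift s).val)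
    fun j => gamma_ne_zero hxi j
  choose s hs using exists_shift xi
  have h1 : ∀ t, s (xi.shift t) = t := fun t => (shift_injective xi (hs (xi.shift t))).symm
  refine ⟨fun mu => c (s mu), ?_, fun mu => ?_⟩
  · have h2 := h1 0
    rw [CosetWeight.shift_zero] at h2
    simp only [h2, hc0]
  · obtain ⟨t, rfl⟩ := exists_shift xi mu
    simp only [CosetWeight.shift_shift, h1]
    exact hc t

lemma denseE_apply (d : Dense lam) (mu : CosetWeight lam) :
    denseE q lam d mu = gamma q (mu.shift (-1)).val * d (mu.shift (-1)) := by
  classical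
  induction d using Finsupp.induction_linear with
  | zero => simp
  | add a b ha hb => rw [map_add, Finsupp.add_apply, ha, hb, Finsupp.add_apply, mul_add]
  | single nu c =>
    rw [denseE, Finsupp.linearCombination_single, Finsupp.smul_apply, Finsupp.single_apply,
      Finsupp.single_apply]
    by_cases hh : nu.shift 1 = mu
    · subst hh
      simp [gamma, mul_comm]
    · rw [if_neg hh, if_neg, smul_zero, mul_zero]
      rintro rfl
      exact hh (by simp)

lemma denseF_apply (d : Dense lam) (mu : CosetWeight lam) :
    denseF lam d mu = d (mu.shift 1) := by
  classical
  induction d using Finsupp.induction_linear with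
  | zero => simp
  | add a b ha hb => rw [map_add, Finsupp.add_apply, ha, hb, Finsupp.add_apply]
  | single nu c =>
    rw [denseF, Finsupp.linearCombination_single, Finsupp.smul_apply, Finsupp.single_apply,
      Finsupp.single_apply]
    by_cases hh : nu.shift (-1) = mu
    · subst hh
      simp
    · rw [if_neg hh, if_neg, smul_zero]
      rintro rfl
      exact hh (by simp)

lemma topRep_dagger_apply (y : Affine) (d : Dense lam) (mu : CosetWeight lam) :
    topRep k Δ q lam (Affine.dagger y) d mu =
      ((loopCoeff 0 y.loop).1 0 0 * mu.val + (k * y.central + Δ * y.deriv)) * d mu +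
        (loopCoeff 0 y.loop).1 1 0 * (gamma q (mu.shift (-1)).val * d (mu.shift (-1))) +
        (loopCoeff 0 y.loop).1 0 1 * d (mu.shift 1) := by
  rw [topRep_apply, Affine.loopCoeff_dagger, neg_zero]
  generalize loopCoeff 0 y.loop = x
  change (x.1 0 0 • denseH lam + x.1 1 0 • denseE q lam + x.1 0 1 • denseF lam +
    (k * y.central + Δ * y.deriv) • 1) d mu = _
  simp only [LinearMap.add_apply, LinearMap.smul_apply, Finsupp.add_apply, Finsupp.smul_apply,
    denseH_apply, denseE_apply, denseF_apply, Module.End.one_apply, smul_eq_mul]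
  ring

/-- The functionals `⟨v_μ, ·⟩`. -/
def normFunctional (k Δ q : ℂ) (c : CosetWeight lam → ℂ) :
    Dense lam →ₗ[ℂ] Module.Dual ℂ (RelaxedVerma k Δ q lam) :=
  Finsupp.linearCombination ℂ fun mu => c mu • (Finsupp.lapply mu ∘ₗ toGround k Δ q lam)

lemma normFunctional_single (c : CosetWeight lam → ℂ) (mu : CosetWeight lam)
    (r : RelaxedVerma k Δ q lam) : normFunctional k Δ q c (Finsupp.single mu 1) r =
      c mu * toGround k Δ q lam r mu := by
  rw [normFunctional, Finsupp.linearCombination_single, one_smul]; rfl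

lemma dense_hom_ext {V : Type} [AddCommGroup V] [Module ℂ V] {F G : Dense lam →ₗ[ℂ] V}
    (hFG : ∀ mu, F (Finsupp.single mu 1) = G (Finsupp.single mu 1)) : F = G :=
  Finsupp.lhom_ext' fun mu => LinearMap.ext_ring (hFG mu)

/-- The adjoint of a nonnegative element is nonpositive and so passes through the projection. The
`f` terms then match by the recursion for `c` at `μ - α`, and the `e` terms by the recursion at `μ`.
-/
lemma dualRep_normFunctional_single {c : CosetWeight lam → ℂ}
    (hc : ∀ mu, c mu = gamma q mu.val * c (mu.shift 1)) {y : Affine} (hy : y ∈ Affine.nonneg)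
    (mu : CosetWeight lam) (r : RelaxedVerma k Δ q lam) :
    dualRep (RelaxedVerma k Δ q lam) y (normFunctional k Δ q c (Finsupp.single mu 1)) r =
      normFunctional k Δ q c (topRep k Δ q lam y (Finsupp.single mu 1)) r := by
  have h1 := hc (mu.shift (-1))
  have h2 := hc mu
  rw [CosetWeight.shift_shift, neg_add_cancel, CosetWeight.shift_zero] at h1
  rw [dualRep_apply, normFunctional_single, toGround_smul (Affine.posProj_dagger hy),
    topRep_dagger_apply, topRep_single]
  simp only [LinearMap.map_add, LinearMap.map_smul, LinearMap.add_apply, LinearMap.smul_apply,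
    normFunctional_single, smul_eq_mul]
  rw [h1]
  linear_combination (loopCoeff 0 y.loop).1 0 1 * toGround k Δ q lam r (mu.shift 1) * h2

lemma dualRep_normFunctional {c : CosetWeight lam → ℂ}
    (hc : ∀ mu, c mu = gamma q mu.val * c (mu.shift 1)) {y : Affine} (hy : y ∈ Affine.nonneg)
    (v : Dense lam) : dualRep (RelaxedVerma k Δ q lam) y (normFunctional k Δ q c v) =
      normFunctional k Δ q c (topRep k Δ q lam y v) :=
  LinearMap.congr_fun (dense_hom_ext
    (F := dualRep (RelaxedVerma k Δ q lam) y ∘ₗ normFunctional k Δ q c)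
    (G := normFunctional k Δ q c ∘ₗ topRep k Δ q lam y)
    fun mu => LinearMap.ext fun r => dualRep_normFunctional_single hc hy mu r) v

/-- Frobenius reciprocity extends `v_μ ↦ ⟨v_μ, ·⟩` to an equivariant map into the contragredient
dual; equivariance of that map is contravariance of the form. -/
theorem exists_shapovalovForm {xi : CosetWeight lam} (hxi : IsGenerating q xi) :
    ∃ B : LinearMap.BilinForm ℂ (RelaxedVerma k Δ q lam), IsShapovalovForm B xi := by
  obtain ⟨c, hc1, hc⟩ := exists_norms hxi
  obtain ⟨F, hF1, hF2⟩ := exists_induced_lift (ρ := groundRep k Δ q lam)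
    (dualRep (RelaxedVerma k Δ q lam)) (normFunctional k Δ q c)
    fun y v => dualRep_normFunctional hc y.2 v
  refine ⟨F, ?_, ?_⟩
  · have h1 : F (groundState xi) = normFunctional k Δ q c (Finsupp.single xi 1) := hF1 _
    rw [h1, normFunctional_single, toGround_groundState, hc1, Finsupp.single_eq_same, mul_one]
  · intro x u w
    rw [hF2, UniversalEnvelopingAlgebra.lift_ι_apply, dualRep_apply]

end Existence

/-! ### Uniqueness of the Shapovalov form and the rank of its matrices -/

/-- Contravariance of a bilinear form. -/
def IsContravariant {k Δ q : ℂ} {lam : WeightCoset}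
    (B : LinearMap.BilinForm ℂ (RelaxedVerma k Δ q lam)) : Prop :=
  ∀ (x : Affine) (u w : RelaxedVerma k Δ q lam), B (iota x • u) w = B u (iota (Affine.dagger x) • w)

/-- The same `u'` works for every coset and every contravariant form. This uniformity keeps the
polynomial entries of the Shapovalov matrix independent of both. -/
lemma exists_adjoint (k Δ q : ℂ) (u : U) : ∃ u' : U, ∀ (lam : WeightCoset)
    (B : LinearMap.BilinForm ℂ (RelaxedVerma k Δ q lam)), IsContravariant B →
      ∀ x y, B (u • x) y = B x (u' • y) := by
  refine enveloping_induction_left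
    { carrier := {u : U | ∃ u' : U, ∀ (lam : WeightCoset)
        (B : LinearMap.BilinForm ℂ (RelaxedVerma k Δ q lam)), IsContravariant B →
          ∀ x y, B (u • x) y = B x (u' • y)}
      zero_mem' := ⟨0, fun lam B _ x y => by
        rw [zero_smul, zero_smul, map_zero, map_zero, LinearMap.zero_apply]⟩
      add_mem' := fun {a b} ⟨a', ha⟩ ⟨b', hb⟩ => ⟨a' + b', fun lam B hB x y => by
        rw [add_smul, add_smul, map_add, map_add, LinearMap.add_apply, ha lam B hB, hb lam B hB]⟩
      smul_mem' := fun c a ⟨a', ha⟩ => ⟨c • a', fun lam B hB x y => by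
        rw [smul_assoc, smul_assoc, LinearMap.map_smul, LinearMap.map_smul, LinearMap.smul_apply,
          ha lam B hB]⟩ } ?_ ?_ u
  · exact ⟨1, fun lam B hB x y => by rw [one_smul, one_smul]⟩
  · rintro u ⟨u', hu⟩ z
    exact ⟨u' * iota (Affine.dagger z), fun lam B hB x y => by
      rw [mul_smul, hB, hu lam B hB, mul_smul]⟩

section Uniqueness

variable {k Δ q : ℂ} {lam : WeightCoset} {B : LinearMap.BilinForm ℂ (RelaxedVerma k Δ q lam)}

lemma IsContravariant.apply_smul (hB : IsContravariant B) (x : Affine)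
    (u w : RelaxedVerma k Δ q lam) : B u (iota x • w) = B (iota (Affine.dagger x) • u) w := by
  rw [hB, Affine.dagger_dagger]

/-- A negative mode moved to the other side becomes a positive mode, which kills `v_μ`. Ground
states of different weights are orthogonal by contravariance under `h_0`. -/
lemma IsContravariant.groundState_apply (hB : IsContravariant B) (mu : CosetWeight lam)
    (r : RelaxedVerma k Δ q lam) :
    B (groundState mu) r = B (groundState mu) (groundState mu) * toGround k Δ q lam r mu := by
  classical
  induction mem_span_negWords r using Submodule.span_induction with
  | mem r hr =>
    obtain ⟨w, nu, rfl⟩ := hr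
    cases w with
    | cons a w =>
      have hp := Affine.dagger_negLetter_mem a
      have h1 : iota (Affine.dagger (negLetter a)) • (groundState mu : RelaxedVerma k Δ q lam) =
          0 := by
        rw [groundState, groundMap_smul (Affine.positive_le_nonneg hp), topRep_positive _ _ _ _ hp]
        exact map_zero _
      rw [wordProd_cons, mul_smul, hB.apply_smul, h1, toGround_negLetter, map_zero,
        LinearMap.zero_apply, Finsupp.zero_apply, mul_zero]
    | nil =>
      rw [wordProd_nil, one_smul, toGround_groundState, Finsupp.single_apply]
      by_cases hnu : nu = mu
      · rw [if_pos hnu, hnu, mul_one]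
      · rw [if_neg hnu, mul_zero]
        have h1 := hB (Affine.mode 0 h) (groundState mu) (groundState nu)
        rw [Affine.dagger_mode, neg_zero, transpose_h, h_smul_groundState, h_smul_groundState,
          LinearMap.map_smul, LinearMap.map_smul, LinearMap.smul_apply, ← sub_eq_zero,
          ← sub_smul] at h1
        refine (smul_eq_zero.mp h1).resolve_left (sub_ne_zero.mpr fun hv => hnu ?_)
        exact CosetWeight.ext hv.symm
  | zero => rw [map_zero, map_zero, Finsupp.zero_apply, mul_zero]
  | add a b _ _ ha hb => rw [map_add, map_add, Finsupp.add_apply, ha, hb, mul_add]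
  | smul c a _ ha =>
    rw [LinearMap.map_smul, LinearMap.map_smul, Finsupp.smul_apply, ha, smul_eq_mul, smul_eq_mul]
    ring

/-- Move `f_0` across in `⟨f v_{μ+α}, v_μ⟩ = ⟨v_{μ+α}, e v_μ⟩`. -/
lemma IsContravariant.norm_eq (hB : IsContravariant B) (mu : CosetWeight lam) :
    B (groundState mu) (groundState mu) =
      gamma q mu.val * B (groundState (mu.shift 1)) (groundState (mu.shift 1)) := by
  have h1 := hB (Affine.mode 0 f) (groundState (mu.shift 1)) (groundState mu)
  rw [Affine.dagger_mode, neg_zero, transpose_f, f_smul_groundState, e_smul_groundState,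
    LinearMap.map_smul, CosetWeight.shift_shift, add_neg_cancel, CosetWeight.shift_zero] at h1
  exact h1

lemma IsContravariant.norm_shift_ne_zero (hB : IsContravariant B) {mu : CosetWeight lam}
    (hmu : IsGenerating q mu) (j : ℕ) :
    B (groundState (mu.shift j)) (groundState (mu.shift j)) ≠ 0 ↔
      B (groundState mu) (groundState mu) ≠ 0 := by
  induction j with
  | zero => rw [Nat.cast_zero, CosetWeight.shift_zero]
  | succ j ih =>
    rw [← ih, hB.norm_eq (mu.shift j), CosetWeight.shift_shift, Nat.cast_succ]
    exact ⟨fun h1 => mul_ne_zero (gamma_ne_zero hmu j) h1, right_ne_zero_of_mul⟩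

/-- The recursion for the norms propagates the normalisation at `ξ` to the whole coset, and the
norms determine all pairings with a ground state. The vectors on which the two forms agree against
everything form a `U`-stable subspace containing the ground states. -/
theorem shapovalovForm_unique {B' : LinearMap.BilinForm ℂ (RelaxedVerma k Δ q lam)}
    {xi : CosetWeight lam} (hxi : IsGenerating q xi) (hB : IsShapovalovForm B xi)
    (hB' : IsShapovalovForm B' xi) : B = B' := by
  have hc : IsContravariant B := hB.contravariant
  have hc' : IsContravariant B' := hB'.contravariant
  have hnorm : ∀ s : ℤ, B (groundState (xi.shift s)) (groundState (xi.shift s)) =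
      B' (groundState (xi.shift s)) (groundState (xi.shift s)) := by
    intro s
    induction s using Int.induction_on with
    -- Going up requires cancelling `γ`, which is allowed from `ξ` on; going down only multiplies by
    -- it.
    | zero => rw [CosetWeight.shift_zero, hB.normalised, hB'.normalised]
    | succ i ih =>
      rw [hc.norm_eq, hc'.norm_eq, CosetWeight.shift_shift] at ih
      exact mul_left_cancel₀ (gamma_ne_zero hxi i) ih
    | pred i ih =>
      rw [hc.norm_eq, hc'.norm_eq, CosetWeight.shift_shift, sub_add_cancel, ih]
  let S : Submodule ℂ (RelaxedVerma k Δ q lam) :=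
    { carrier := {r | ∀ w, B r w = B' r w}
      zero_mem' := fun w => by
        rw [LinearMap.map_zero, LinearMap.map_zero]
      add_mem' := fun {a b} ha hb w => by
        rw [LinearMap.map_add, LinearMap.map_add, LinearMap.add_apply, LinearMap.add_apply,
          ha w, hb w]
      smul_mem' := fun c a ha w => by
        rw [LinearMap.map_smul, LinearMap.map_smul, LinearMap.smul_apply, LinearMap.smul_apply,
          ha w] }
  have hmem : ∀ r, r ∈ S := by
    refine mem_of_groundState_mem S (fun u r hr w => ?_) fun mu w => ?_
    · obtain ⟨u', hu'⟩ := exists_adjoint k Δ q u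
      exact (hu' lam B hc r w).trans ((hr (u' • w)).trans (hu' lam B' hc' r w).symm)
    · obtain ⟨s, rfl⟩ := exists_shift xi mu
      rw [hc.groundState_apply, hc'.groundState_apply, hnorm]
  exact LinearMap.ext fun r => LinearMap.ext fun w => hmem r w

lemma IsShapovalovForm.norm_ne_zero {nu xi : CosetWeight lam} (hnu : IsGenerating q nu)
    (hxi : IsGenerating q xi) (hB : IsShapovalovForm B xi) (n : ℕ) :
    B (groundState (nu.shift n)) (groundState (nu.shift n)) ≠ 0 := by
  have hc : IsContravariant B := hB.contravariant
  rw [hc.norm_shift_ne_zero hnu]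
  obtain ⟨s, rfl⟩ := exists_shift xi nu
  -- Since `ν` may lie below or above `ξ`, both are compared with a common higher weight: `s + |s|`
  -- is nonnegative.
  rw [← hc.norm_shift_ne_zero hnu s.natAbs, CosetWeight.shift_shift]
  obtain ⟨j, hj⟩ : ∃ j : ℕ, s + s.natAbs = j := ⟨(s + s.natAbs).toNat, by omega⟩
  rw [hj, hc.norm_shift_ne_zero hxi, hB.normalised]
  exact one_ne_zero

end Uniqueness

/-- Moving the left monomial to the right turns each entry into the norm of `v_{ν+nα}` times a
ground coefficient that is polynomial in the weight. The norm is a common nonzero factor, so neither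
it nor the choice of `ξ` affects the rank. -/
theorem exists_generic_shapovalov_rank (k Δ q : ℂ) (n : ℕ) : ∃ (r : ℕ) (E : Set ℂ), E.Finite ∧
    ∀ (lam : WeightCoset) (nu xi : CosetWeight lam), nu.val ∉ E →
      IsGenerating q nu → IsGenerating q xi →
      ∀ B : LinearMap.BilinForm ℂ (RelaxedVerma k Δ q lam), IsShapovalovForm B xi →
        (shapovalovMatrix B nu n).rank = r := by
  choose adj hadj using exists_adjoint k Δ q
  choose p hp using fun P Q : PBW n =>
    exists_coeff_polynomial_coset k Δ q (adj P.monomial * Q.monomial) 0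
  obtain ⟨r, E, hE, hr⟩ := exists_generic_rank
    -- The ground state has weight `ν + nα`, that is `ν + 2n`.
    (Matrix.of fun P Q : PBW n => (p P Q).comp (X + C (2 * (n : ℂ))))
  refine ⟨r, E, hE, fun lam nu xi hnuE hnu hxi B hB => ?_⟩
  have hc : IsContravariant B := hB.contravariant
  have h1 : shapovalovMatrix B nu n =
      B (groundState (nu.shift n)) (groundState (nu.shift n)) •
        (Matrix.of fun P Q : PBW n => (p P Q).comp (X + C (2 * (n : ℂ)))).map (eval nu.val) := by
    ext P Q
    have h2 := hp P Q lam (nu.shift n)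
    rw [CosetWeight.shift_zero, mul_smul, CosetWeight.val_shift] at h2
    rw [shapovalovMatrix, Matrix.of_apply, hadj _ lam B hc, hc.groundState_apply, h2,
      Matrix.smul_apply, Matrix.map_apply, Matrix.of_apply, eval_comp, smul_eq_mul]
    congr 2
    simp
    ring
  rw [h1, Matrix.rank_smul_of_mem_nonZeroDivisors _
    (mem_nonZeroDivisors_of_ne_zero (hB.norm_ne_zero hnu hxi n)), hr _ hnuE]

end RelaxedSl2

end

open RelaxedSl2

theorem mainTheorem6 (k Δ q : ℂ) :
    -- the weight spaces of the relaxed modules are finite-dimensional, so that string functions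
    -- are defined
    (∀ (lam : WeightCoset) (mu n : ℂ),
      FiniteDimensional ℂ (weightSpace (RelaxedModule k Δ q lam) mu n)) ∧
    -- the positive limiting string functions exist and do not depend on the coset
    (∃ S : ℂ → ℕ, ∀ lam : WeightCoset,
      IsPositiveLimitingStringFunction (RelaxedModule k Δ q lam) lam S) ∧
    -- each generating ground state defines a Shapovalov form
    (∀ (lam : WeightCoset) (xi : CosetWeight lam), IsGenerating q xi →
      ∃! B : LinearMap.BilinForm ℂ (RelaxedVerma k Δ q lam), IsShapovalovForm B xi) ∧
    -- the rank of the Shapovalov matrices is constant outside a finite set of weights, hence for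
    -- all weights of sufficiently large real part
    (∀ n : ℕ, ∃ (r : ℕ) (E : Set ℂ), E.Finite ∧
      ∀ (lam : WeightCoset) (nu xi : CosetWeight lam), nu.val ∉ E →
        IsGenerating q nu → IsGenerating q xi →
        ∀ B : LinearMap.BilinForm ℂ (RelaxedVerma k Δ q lam), IsShapovalovForm B xi →
          (shapovalovMatrix B nu n).rank = r) := by
  refine ⟨fun lam mu n => finiteDimensional_weightSpace mu n,
    exists_limitingStringFunction k Δ q, fun lam xi hxi => ?_,
    exists_generic_shapovalov_rank k Δ q⟩
  obtain ⟨B, hB⟩ := exists_shapovalovForm (k := k) (Δ := Δ) hxi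
  exact ⟨B, hB, fun B' hB' => shapovalovForm_unique hxi hB' hB⟩
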